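/- Let $|\psi\rangle$ be a pure state (unit vector) of $N$ qubits. A subcubic tree with $N$ leaves is a finite tree in which every vertex has exactly $1$ or $3$ incident edges and whose vertices with exactly one incident edge (the leaves) are identified with the $N$ qubits. For an edge $e$ of such a tree $T$, the two connected components of $T\setminus e$ induce a bipartition $(A_T^e,B_T^e)$ of the qubits. Let $E_{A,B}(|\psi\rangle)=-\mathrm{Tr}(\rho_A\log_2\rho_A)$ with $\rho_A=\mathrm{Tr}_B|\psi\rangle\langle\psi|$. The entropic entanglement width of $|\psi\rangle$ is $$E_{\mathrm{wd}}(|\psi\rangle)=\min_T\max_{e\in T}E_{A_T^e,B_T^e}(|\psi\rangle),$$ where $T$ runs over all subcubic trees with $N$ leaves; for $N\le 1$, where no such tree exists, put $E_{\mathrm{wd}}:=0$. For an $N$-qubit state $|\psi\rangle$ and an $n$-qubit state $|\varphi\rangle$ with $n\le N$, write $|\psi\rangle\ge_{\mathrm{LOCC}}|\varphi\rangle$ if there is a set $A$ of $n$ of the $N$ qubits such that $|\psi\rangle$ can be transformed into $|\varphi\rangle^{A}|0\rangle^{\bar A}$ with unit probability by a finite protocol of local operations (each qubit being a party, with local ancillas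 of finite dimension allowed) and classical communication. A type II monotone is a real-valued functional $E$ of qubit states, for all numbers of qubits, such that $E(|\psi\rangle)\ge E(|\varphi\rangle)$ whenever $|\psi\rangle\ge_{\mathrm{LOCC}}|\varphi\rangle$, for all $N\ge n$, all $N$-qubit states $|\psi\rangle$ and all $n$-qubit states $|\varphi\rangle$. **Theorem.** For $N\ge 2$ the minimum defining $E_{\mathrm{wd}}$ is attained. The entropic entanglement width is a type II monotone. Moreover, $E_{\mathrm{wd}}(|\psi\rangle|0\rangle)=E_{\mathrm{wd}}(|\psi\rangle)$ for every state $|\psi\rangle$ of any number of qubits. -/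

import Mathlib

noncomputable section

namespace EntWidth

/-- Vectors of an `N`-partite system all of whose parties have the finite-dimensional Hilbert space
with orthonormal basis indexed by `D`, written in the product basis. -/
abbrev MultiVec (N : ℕ) (D : Type) : Type := EuclideanSpace ℂ (Fin N → D)

/-- Vectors of an `N`-qubit system. The `N`-qubit pure states are those of norm `1`. -/
abbrev QubitVec (N : ℕ) : Type := MultiVec N (Fin 2)

/-! ### Bipartite entanglement entropy -/

/-- The matrix `|ψ⟩⟨ψ|`. -/
def densityMatrix {N : ℕ} {D : Type} (ψ : MultiVec N D) :
    Matrix (Fin N → D) (Fin N → D) ℂ :=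
  Matrix.of fun x y => ψ x * star (ψ y)

open Classical in
/-- The joint basis label that is `x` on the parties in `A` and `z` on the other parties. -/
def glue {N : ℕ} {D : Type} (A : Set (Fin N)) (x : {j // j ∈ A} → D) (z : {j // j ∉ A} → D) :
    Fin N → D :=
  fun j => if h : j ∈ A then x ⟨j, h⟩ else z ⟨j, h⟩

open Classical in
/-- The partial trace over the parties outside `A`. -/
def partialTrace {N : ℕ} {D : Type} [Fintype D] (A : Set (Fin N))
    (ρ : Matrix (Fin N → D) (Fin N → D) ℂ) :
    Matrix ({j // j ∈ A} → D) ({j // j ∈ A} → D) ℂ :=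
  Matrix.of fun x y => ∑ z : {j // j ∉ A} → D, ρ (glue A x z) (glue A y z)

/-- The reduced density operator `ρ_A = Tr_B |ψ⟩⟨ψ|`, where `B` is the complement of `A`. -/
def reducedDensity {N : ℕ} {D : Type} [Fintype D] (A : Set (Fin N)) (ψ : MultiVec N D) :
    Matrix ({j // j ∈ A} → D) ({j // j ∈ A} → D) ℂ :=
  partialTrace A (densityMatrix ψ)

theorem reducedDensity_isHermitian {N : ℕ} {D : Type} [Fintype D] (A : Set (Fin N))
    (ψ : MultiVec N D) : (reducedDensity A ψ).IsHermitian := by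
  ext x y
  simp [reducedDensity, partialTrace, densityMatrix, Matrix.conjTranspose_apply, mul_comm]

/-- The von Neumann entropy `-Tr(ρ log₂ ρ)` of a Hermitian matrix `ρ`, computed from its
eigenvalues with multiplicity, with the usual convention `0 log₂ 0 = 0`. -/
def vonNeumannEntropy {ι : Type} [Fintype ι] [DecidableEq ι] (ρ : Matrix ι ι ℂ)
    (hρ : ρ.IsHermitian) : ℝ :=
  -∑ i, hρ.eigenvalues i * Real.logb 2 (hρ.eigenvalues i)

open Classical in
/-- The bipartite entanglement entropy `E_{A,B}(ψ)`, where `B` is the complement of `A`. -/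
def entanglementEntropy {N : ℕ} {D : Type} [Fintype D] (A : Set (Fin N)) (ψ : MultiVec N D) : ℝ :=
  vonNeumannEntropy (reducedDensity A ψ) (reducedDensity_isHermitian A ψ)

/-! ### Subcubic trees and the entropic entanglement width -/

/-- A subcubic tree with exactly `N` leaves, identified with the parties `0, …, N - 1`: a finite
tree each of whose vertices has exactly `1` or `3` incident edges; the leaves are the vertices with
exactly one incident edge. -/
structure SubcubicTree (N : ℕ) where
  /-- the vertices -/
  V : Type
  /-- there are finitely many vertices -/
  finite_V : Finite V
  /-- the underlying graph -/
  graph : SimpleGraph V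
  isTree : graph.IsTree
  subcubic : ∀ v : V, (graph.neighborSet v).ncard = 1 ∨ (graph.neighborSet v).ncard = 3
  /-- the identification of the parties with the leaves -/
  leaf : Fin N ≃ {v : V // (graph.neighborSet v).ncard = 1}

/-- For an edge `e` of `T`, given with an orientation as a dart `d`, the set of the parties whose
leaf lies in the same connected component of `T \ e` as the first endpoint of `d`. The other part of
the bipartition induced by `e` is its complement, which belongs to the reversed dart. -/
def SubcubicTree.side {N : ℕ} (T : SubcubicTree N) (d : T.graph.Dart) : Set (Fin N) :=
  {i | (T.graph.deleteEdges {d.edge}).Reachable d.fst (T.leaf i).1}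

/-- The maximum over all edges `e` of `T` of the entanglement entropy with respect to the
bipartition induced by `e` (a supremum over a finite nonempty set). -/
def SubcubicTree.maxEntropy {N : ℕ} {D : Type} [Fintype D] (T : SubcubicTree N)
    (ψ : MultiVec N D) : ℝ :=
  ⨆ d : T.graph.Dart, entanglementEntropy (T.side d) ψ

/-- The values over which the entropic entanglement width is minimized. -/
def widthValues {N : ℕ} {D : Type} [Fintype D] (ψ : MultiVec N D) : Set ℝ :=
  {w | ∃ T : SubcubicTree N, w = T.maxEntropy ψ}

/-- The entropic entanglement width: the minimum over all subcubic trees with `N` leaves of the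
maximal entanglement entropy across an edge. For `N ≤ 1` there is no subcubic tree with `N` leaves
and no bipartition into nonempty parts, and the value is `0`, as `sInf ∅ = 0`. -/
def entropicWidth (N : ℕ) (ψ : QubitVec N) : ℝ := sInf (widthValues ψ)

/-! ### LOCC -/

/-- The operator `M` applied to party `i` (and the identity to all other parties). -/
def applyAt {N : ℕ} {D : Type} [Fintype D] (i : Fin N) (M : Matrix D D ℂ) (ψ : MultiVec N D) :
    MultiVec N D :=
  WithLp.toLp 2 fun x => ∑ k : D, M (x i) k * ψ (Function.update x i k)

/-- LOCC protocols of `N` parties with finitely many rounds. Either the protocol stops, or some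
party `i` performs a generalized measurement with finitely many outcomes, given by Kraus operators
`K k` with `∑ k, (K k)ᴴ K k = 1`, and announces the outcome `k` to all parties, which go on with
the protocol `next k`. -/
inductive Protocol (N : ℕ) (D : Type) [Fintype D] [DecidableEq D] : Type
  | stop_here : Protocol N D
  | measure (i : Fin N) (m : ℕ) (K : Fin m → Matrix D D ℂ)
      (hK : ∑ k, (K k).conjTranspose * K k = 1) (next : Fin m → Protocol N D) : Protocol N D

/-- With unit probability the protocol turns `ψ` into `φ`: the unnormalized final vector of every
branch is a multiple of `φ`. The squared norm of that vector is the probability of the branch, so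
that the multiple `0` stands for a branch that does not occur. -/
def Protocol.Yields {N : ℕ} {D : Type} [Fintype D] [DecidableEq D] :
    Protocol N D → MultiVec N D → MultiVec N D → Prop
  | .stop_here, ψ, φ => ∃ c : ℂ, ψ = c • φ
  | .measure i _ K _ next, ψ, φ => ∀ k, (next k).Yields (applyAt i (K k) ψ) φ

open Classical in
/-- Every party gets, next to its qubit, an ancilla with basis `0, …, a`, in the state `|0⟩`. -/
def withAncillas {N : ℕ} (a : ℕ) (ψ : QubitVec N) : MultiVec N (Fin 2 × Fin (a + 1)) :=
  WithLp.toLp 2 fun x => if ∀ j, (x j).2 = 0 then ψ (fun j => (x j).1) else 0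

/-- `ψ` can be transformed into `φ` by means of LOCC with unit probability, every qubit being a
party of its own. The parties may use local ancillas of any finite dimension; they reset them to
`|0⟩` before the end, which is itself a local operation. -/
def LOCCConvertible {N : ℕ} (ψ φ : QubitVec N) : Prop :=
  ∃ (a : ℕ) (P : Protocol N (Fin 2 × Fin (a + 1))), P.Yields (withAncillas a ψ) (withAncillas a φ)

open Classical in
/-- The state of `N` qubits that is `φ` on the qubits `f 0, …, f (n - 1)`, in this order, and `|0⟩`
on all other qubits. -/
def padZero {n N : ℕ} (f : Fin n ↪ Fin N) (φ : QubitVec n) : QubitVec N :=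
  WithLp.toLp 2 fun x => if ∀ j, j ∉ Set.range f → x j = 0 then φ (fun k => x (f k)) else 0

/-- `|ψ⟩|0⟩`, the state `ψ` with an uncorrelated qubit in the state `|0⟩` appended. -/
def appendZero {N : ℕ} (ψ : QubitVec N) : QubitVec (N + 1) := padZero Fin.castSuccEmb ψ

/-- `ψ ≥_LOCC φ`: for some set `A` of `n` of the `N` qubits, `ψ` can be transformed into `φ` on `A`
together with `|0⟩` on every qubit outside `A`, by LOCC with unit probability. -/
def LOCCGe {N n : ℕ} (ψ : QubitVec N) (φ : QubitVec n) : Prop :=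
  ∃ f : Fin n ↪ Fin N, LOCCConvertible ψ (padZero f φ)

/-- Type II entanglement monotones: functionals `E` of qubit states, for all numbers of qubits, that
do not increase under deterministic LOCC conversion. -/
def IsTypeIIMonotone (E : (n : ℕ) → QubitVec n → ℝ) : Prop :=
  ∀ (N n : ℕ), n ≤ N → ∀ (ψ : QubitVec N) (φ : QubitVec n), ‖ψ‖ = 1 → ‖φ‖ = 1 →
    LOCCGe ψ φ → E n φ ≤ E N ψ

end EntWidth

end

noncomputable section

namespace EntWidth

open Matrix
open scoped ComplexOrder

/-! ### Spectral functions of Hermitian matrices -/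

/-! The proof has an analytic half, in which the bipartition is fixed, and a combinatorial half
about trees. Analytic half: a measurement by a party on one side leaves the reduced operator of the
other side unchanged on average, so concavity of the entropy shows that the mean entanglement does
not grow. Concavity comes from Klein's inequality (`sum_mul_log_le_of_doublyStochastic`,
`sum_scaledEntropy_le`), and the Schmidt symmetry `matrixEntropy_conjTranspose` makes it available
for parties on either side. Entropies are weighted by the trace, so branches stay unnormalized and
those of probability zero need no separate treatment; induction over the protocol gives
`LOCCConvertible.entanglementEntropy_le`. Ancillas and extra qubits in a fixed state only extend the
coefficient matrix by zeros and leave the entropy alone (`vecEntropy_extend`). Combinatorial half: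
deleting a leaf and suppressing its neighbour yields a subcubic tree whose bipartitions are
restrictions of old ones; iterated, this restricts a tree to any set of at least two leaves
(`SubcubicTree.exists_restrict`). An optimal tree for the source state thus restricts to a tree for
the target state that is no worse at any edge, which is monotonicity. Conversely, attaching a leaf
to a subdivided edge adds only bipartitions that are trivial on the old leaves
(`SubcubicTree.exists_insertLeaf`), which gives invariance under appending a qubit in state zero.
The minimum is attained because there are only finitely many bipartitions, hence finitely many
possible values. -/

theorem sum_eigenvalues_eq_sum_roots {ι : Type*} [Fintype ι] [DecidableEq ι] {ρ : Matrix ι ι ℂ}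
    (hρ : ρ.IsHermitian) (g : ℝ → ℝ) :
    ∑ i, g (hρ.eigenvalues i) = (ρ.charpoly.roots.map fun z => g z.re).sum := by
  rw [hρ.roots_charpoly_eq_eigenvalues, Multiset.map_map]
  exact congrArg Multiset.sum (Multiset.map_congr rfl fun i _ => by simp)

/-- Hermitian matrices, possibly of different sizes, whose characteristic polynomials agree up to
powers of `X` have the same spectral sums. -/
theorem sum_eigenvalues_congr {ι κ : Type*} [Fintype ι] [DecidableEq ι] [Fintype κ] [DecidableEq κ]
    {ρ : Matrix ι ι ℂ} {σ : Matrix κ κ ℂ} (hρ : ρ.IsHermitian) (hσ : σ.IsHermitian) {a b : ℕ}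
    (h : Polynomial.X ^ a * ρ.charpoly = Polynomial.X ^ b * σ.charpoly)
    (g : ℝ → ℝ) (hg : g 0 = 0) :
    ∑ i, g (hρ.eigenvalues i) = ∑ i, g (hσ.eigenvalues i) := by
  -- The factor `X ^ c` contributes `c` roots equal to zero, which `g` ignores because `g 0 = 0`.
  have key : ∀ (c : ℕ) (q : Polynomial ℂ), q.Monic →
      ((Polynomial.X ^ c * q).roots.map fun z : ℂ => g z.re).sum =
        (q.roots.map fun z : ℂ => g z.re).sum := by
    intro c q hq
    rw [Polynomial.roots_mul (mul_ne_zero (pow_ne_zero _ Polynomial.X_ne_zero) hq.ne_zero),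
      Polynomial.roots_pow, Polynomial.roots_X, Multiset.map_add, Multiset.sum_add]
    simp [Multiset.nsmul_singleton, hg]
  rw [sum_eigenvalues_eq_sum_roots, sum_eigenvalues_eq_sum_roots,
    ← key a _ (Matrix.charpoly_monic ρ), h, key b _ (Matrix.charpoly_monic σ)]

theorem re_trace_eq_sum_eigenvalues {ι : Type*} [Fintype ι] [DecidableEq ι] {ρ : Matrix ι ι ℂ}
    (hρ : ρ.IsHermitian) : ρ.trace.re = ∑ i, hρ.eigenvalues i := by
  simp [hρ.trace_eq_sum_eigenvalues]

/-- The diagonal of a Hermitian matrix in an orthonormal basis is the image of its eigenvalues under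
a doubly stochastic matrix. -/
theorem exists_doublyStochastic_diag {ι : Type*} [Fintype ι] [DecidableEq ι] {σ : Matrix ι ι ℂ}
    (hσ : σ.IsHermitian) (U : Matrix.unitaryGroup ι ℂ) :
    ∃ p : ι → ι → ℝ, (∀ i j, 0 ≤ p i j) ∧ (∀ i, ∑ j, p i j = 1) ∧ (∀ j, ∑ i, p i j = 1) ∧
      ∀ i, ((star (U : Matrix ι ι ℂ)) * σ * U) i i = ((∑ j, p i j * hσ.eigenvalues j : ℝ) : ℂ) := by
  set W := hσ.eigenvectorUnitary
  -- `Q` holds the overlaps of the basis `U` with the eigenbasis of `σ`. Their squared moduli form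
  -- the required matrix, and unitarity of `Q` gives both stochasticity conditions.
  set Q : Matrix.unitaryGroup ι ℂ := star U * W
  have hQ1 : (Q : Matrix ι ι ℂ) * star (Q : Matrix ι ι ℂ) = 1 := Unitary.coe_mul_star_self Q
  have hQ2 : star (Q : Matrix ι ι ℂ) * (Q : Matrix ι ι ℂ) = 1 := Unitary.coe_star_mul_self Q
  have hdec : star (U : Matrix ι ι ℂ) * σ * (U : Matrix ι ι ℂ) =
      (Q : Matrix ι ι ℂ) * diagonal (RCLike.ofReal ∘ hσ.eigenvalues) * star (Q : Matrix ι ι ℂ) := by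
    conv_lhs => rw [hσ.spectral_theorem, Unitary.conjStarAlgAut_apply]
    simp [Q, W, mul_assoc]
  refine ⟨fun i j => Complex.normSq ((Q : Matrix ι ι ℂ) i j), fun i j => Complex.normSq_nonneg _,
    fun i => ?_, fun j => ?_, fun i => ?_⟩
  · have := congr_fun (congr_fun hQ1 i) i
    rw [Matrix.mul_apply, Matrix.one_apply_eq] at this
    have h2 := congrArg Complex.re this
    simpa [Matrix.star_apply, Complex.normSq_apply] using h2
  · have := congr_fun (congr_fun hQ2 j) j
    rw [Matrix.mul_apply, Matrix.one_apply_eq] at this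
    have h2 := congrArg Complex.re this
    simpa [Matrix.star_apply, Complex.normSq_apply] using h2
  · rw [hdec, Matrix.mul_apply]
    push_cast
    refine Finset.sum_congr rfl fun j _ => ?_
    rw [Matrix.mul_diagonal, Matrix.star_apply, Complex.normSq_eq_conj_mul_self]
    simp
    ring

/-- Klein's inequality in terms of the overlaps of two eigenbases. -/
theorem sum_mul_log_le_of_doublyStochastic {ι : Type*} [Fintype ι] {p : ι → ι → ℝ}
    (hp : ∀ i j, 0 ≤ p i j) (hrow : ∀ i, ∑ j, p i j = 1) (hcol : ∀ j, ∑ i, p i j = 1)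
    {l m : ι → ℝ} (hl : ∀ i, 0 ≤ l i) (hm : ∀ i, 0 ≤ m i)
    (hsupp : ∀ i, l i = 0 → ∑ j, p i j * m j = 0) :
    ∑ j, m j * (Real.log (∑ k, m k) - Real.log (m j)) ≤
      ∑ i, (∑ j, p i j * m j) * (Real.log (∑ k, l k) - Real.log (l i)) := by
  set T := ∑ k, m k
  set t := ∑ k, l k
  have hT : 0 ≤ T := Finset.sum_nonneg fun i _ => hm i
  have ht : 0 ≤ t := Finset.sum_nonneg fun i _ => hl i
  -- This is `log x ≤ x - 1` at `x = T * l i / (m j * t)`, multiplied by `p i j * m j`. Summed over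
  -- `i` and `j`, the corrections give `t * (T / t) - T`.
  have term : ∀ i j, p i j * m j * (Real.log T - Real.log (m j)) ≤
      p i j * m j * (Real.log t - Real.log (l i)) + (p i j * (l i * (T / t)) - p i j * m j) := by
    intro i j
    have hpm := mul_nonneg (hp i j) (hm j)
    rcases hpm.eq_or_lt with h0 | hpos
    · rw [← h0]
      have := mul_nonneg (hp i j) (mul_nonneg (hl i) (div_nonneg hT ht))
      linarith
    · have hmj : 0 < m j := (hm j).lt_of_ne fun h => by simp [← h] at hpos
      have hli : 0 < l i := (hl i).lt_of_ne fun h => by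
        have h1 := hsupp i h.symm
        rw [Finset.sum_eq_zero_iff_of_nonneg fun j _ => mul_nonneg (hp i j) (hm j)] at h1
        exact hpos.ne' (h1 j (Finset.mem_univ j))
      have hTp : 0 < T := hmj.trans_le (Finset.single_le_sum (fun i _ => hm i) (Finset.mem_univ j))
      have htp : 0 < t := hli.trans_le (Finset.single_le_sum (fun i _ => hl i) (Finset.mem_univ i))
      have hlog := Real.log_le_sub_one_of_pos
        (div_pos (mul_pos hTp hli) (mul_pos hmj htp))
      rw [Real.log_div (mul_pos hTp hli).ne' (mul_pos hmj htp).ne',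
        Real.log_mul hTp.ne' hli.ne', Real.log_mul hmj.ne' htp.ne'] at hlog
      have h2 := mul_le_mul_of_nonneg_left hlog hpm
      have h3 : p i j * m j * (T * l i / (m j * t) - 1) =
          p i j * (l i * (T / t)) - p i j * m j := by
        field_simp
      rw [h3] at h2
      linarith
  calc ∑ j, m j * (Real.log T - Real.log (m j))
      = ∑ i, ∑ j, p i j * m j * (Real.log T - Real.log (m j)) := by
        rw [Finset.sum_comm]
        refine Finset.sum_congr rfl fun j _ => ?_
        simp_rw [mul_assoc]
        rw [← Finset.sum_mul, hcol, one_mul]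
    _ ≤ ∑ i, ∑ j, (p i j * m j * (Real.log t - Real.log (l i)) +
          (p i j * (l i * (T / t)) - p i j * m j)) :=
        Finset.sum_le_sum fun i _ => Finset.sum_le_sum fun j _ => term i j
    _ = ∑ i, (∑ j, p i j * m j) * (Real.log t - Real.log (l i)) +
          (∑ i, ∑ j, p i j * (l i * (T / t)) - ∑ i, ∑ j, p i j * m j) := by
        simp_rw [Finset.sum_add_distrib, Finset.sum_sub_distrib, Finset.sum_mul]
    _ = ∑ i, (∑ j, p i j * m j) * (Real.log t - Real.log (l i)) + (t * (T / t) - T) := by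
        congr 2
        · simp_rw [← Finset.sum_mul, hrow, one_mul]
          rw [← Finset.sum_mul]
        · rw [Finset.sum_comm]
          simp_rw [← Finset.sum_mul, hcol, one_mul]
          rfl
    _ ≤ _ := by
        -- Equality holds unless `t = 0`, when the left side is `0` by the convention for division.
        have : t * (T / t) ≤ T := by
          rw [mul_div_left_comm]
          exact mul_le_of_le_one_right hT (div_self_le_one t)
        linarith

/-- The entropy, in nats, of an unnormalized density operator: `Tr ρ` times the entropy of
`ρ / Tr ρ`. -/
def scaledEntropy {ι : Type*} [Fintype ι] [DecidableEq ι] (ρ : Matrix ι ι ℂ)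
    (hρ : ρ.IsHermitian) : ℝ :=
  ∑ i, hρ.eigenvalues i * (Real.log ρ.trace.re - Real.log (hρ.eigenvalues i))

theorem scaledEntropy_nonneg {ι : Type*} [Fintype ι] [DecidableEq ι] {ρ : Matrix ι ι ℂ}
    (hρ : ρ.PosSemidef) : 0 ≤ scaledEntropy ρ hρ.isHermitian := by
  refine Finset.sum_nonneg fun i _ => ?_
  have h0 := hρ.eigenvalues_nonneg
  rcases (h0 i).eq_or_lt with h | h
  · simp [← h]
  · refine mul_nonneg h.le (sub_nonneg.2 (Real.log_le_log h ?_))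
    rw [re_trace_eq_sum_eigenvalues hρ.isHermitian]
    exact Finset.single_le_sum (fun i _ => h0 i) (Finset.mem_univ i)

theorem scaledEntropy_eq_zero_of_subsingleton {ι : Type*} [Fintype ι] [DecidableEq ι]
    (hι : Subsingleton ι) {ρ : Matrix ι ι ℂ} (hρ : ρ.IsHermitian) : scaledEntropy ρ hρ = 0 := by
  rw [scaledEntropy, re_trace_eq_sum_eigenvalues hρ]
  refine Finset.sum_eq_zero fun i _ => ?_
  rw [Fintype.sum_subsingleton _ i, sub_self, mul_zero]

theorem scaledEntropy_congr {ι κ : Type*} [Fintype ι] [DecidableEq ι] [Fintype κ] [DecidableEq κ]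
    {ρ : Matrix ι ι ℂ} {σ : Matrix κ κ ℂ} (hρ : ρ.IsHermitian) (hσ : σ.IsHermitian) {a b : ℕ}
    (h : Polynomial.X ^ a * ρ.charpoly = Polynomial.X ^ b * σ.charpoly) :
    scaledEntropy ρ hρ = scaledEntropy σ hσ ∧ ρ.trace.re = σ.trace.re := by
  have ht : ρ.trace.re = σ.trace.re := by
    rw [re_trace_eq_sum_eigenvalues hρ, re_trace_eq_sum_eigenvalues hσ]
    exact sum_eigenvalues_congr hρ hσ h (fun x => x) rfl
  refine ⟨?_, ht⟩
  rw [scaledEntropy, scaledEntropy, ht]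
  exact sum_eigenvalues_congr hρ hσ h (fun x => x * (Real.log σ.trace.re - Real.log x)) (by simp)

/-- Concavity of the von Neumann entropy, for unnormalized operators. -/
theorem sum_scaledEntropy_le {ι κ : Type*} [Fintype ι] [DecidableEq ι] [Fintype κ]
    {ρ : Matrix ι ι ℂ} (hρ : ρ.IsHermitian) {σ : κ → Matrix ι ι ℂ} (hσ : ∀ k, (σ k).PosSemidef)
    {c : κ → ℝ} (hc : ∀ k, 0 ≤ c k) (h : ρ = ∑ k, (c k : ℂ) • σ k) :
    ∑ k, c k * scaledEntropy (σ k) (hσ k).isHermitian ≤ scaledEntropy ρ hρ := by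
  have hex := fun k => exists_doublyStochastic_diag (hσ k).isHermitian hρ.eigenvectorUnitary
  choose p hp hrow hcol hd using hex
  set l := hρ.eigenvalues
  have hm : ∀ k i, 0 ≤ (hσ k).isHermitian.eigenvalues i := fun k => (hσ k).eigenvalues_nonneg
  -- In the eigenbasis of `ρ`, each eigenvalue is the weighted sum of the diagonal entries of the `σ
  -- k`.
  have hl : ∀ i, l i = ∑ k, c k * ∑ j, p k i j * (hσ k).isHermitian.eigenvalues j := by
    intro i
    have h1 := hρ.conjStarAlgAut_star_eigenvectorUnitary
    rw [Unitary.conjStarAlgAut_star_apply] at h1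
    have h2 := congr_fun (congr_fun h1 i) i
    rw [diagonal_apply_eq] at h2
    have h3 : ∀ U : Matrix ι ι ℂ, star U * ρ * U = star U * (∑ k, (c k : ℂ) • σ k) * U :=
      fun U => by rw [← h]
    rw [h3, Matrix.mul_sum, Matrix.sum_mul, Matrix.sum_apply] at h2
    simp only [Matrix.mul_smul, Matrix.smul_mul, Matrix.smul_apply, hd] at h2
    have h4 : ((l i : ℝ) : ℂ) =
        ((∑ k, c k * ∑ j, p k i j * (hσ k).isHermitian.eigenvalues j : ℝ) : ℂ) := by
      rw [Complex.ofReal_sum]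
      simp only [Complex.ofReal_mul]
      exact h2.symm
    exact_mod_cast h4
  have hdn : ∀ k i, 0 ≤ ∑ j, p k i j * (hσ k).isHermitian.eigenvalues j := fun k i =>
    Finset.sum_nonneg fun j _ => mul_nonneg (hp k i j) (hm k j)
  have hl0 : ∀ i, 0 ≤ l i := fun i => by
    rw [hl]; exact Finset.sum_nonneg fun k _ => mul_nonneg (hc k) (hdn k i)
  have step : ∀ k, c k * scaledEntropy (σ k) (hσ k).isHermitian ≤
      ∑ i, c k * (∑ j, p k i j * (hσ k).isHermitian.eigenvalues j) *
        (Real.log (∑ i, l i) - Real.log (l i)) := by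
    intro k
    rcases (hc k).eq_or_lt with h0 | hpos
    · simp [← h0]
    · simp_rw [mul_assoc (c k)]
      rw [← Finset.mul_sum]
      refine mul_le_mul_of_nonneg_left ?_ (hc k)
      rw [scaledEntropy, re_trace_eq_sum_eigenvalues (hσ k).isHermitian]
      refine sum_mul_log_le_of_doublyStochastic (hp k) (hrow k) (hcol k) hl0 (hm k) fun i hi => ?_
      -- A zero eigenvalue of `ρ` forces the corresponding diagonal entry of every `σ k` of positive
      -- weight to vanish; this is the support condition of Klein's inequality.
      rw [hl, Finset.sum_eq_zero_iff_of_nonneg fun k _ => mul_nonneg (hc k) (hdn k i)] at hi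
      exact (mul_eq_zero.1 (hi k (Finset.mem_univ k))).resolve_left hpos.ne'
  calc _ ≤ ∑ k, ∑ i, c k * (∑ j, p k i j * (hσ k).isHermitian.eigenvalues j) *
        (Real.log (∑ i, l i) - Real.log (l i)) := Finset.sum_le_sum fun k _ => step k
    _ = scaledEntropy ρ hρ := by
      rw [Finset.sum_comm, scaledEntropy, re_trace_eq_sum_eigenvalues hρ]
      refine Finset.sum_congr rfl fun i _ => ?_
      rw [← Finset.sum_mul, ← hl]

/-! ### Entanglement of a bipartite vector given by its coefficient matrix -/

/-- The unnormalized entanglement entropy, in nats, of the bipartite vector with coefficients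
`M`. -/
def matrixEntropy {m n : Type*} [Fintype m] [DecidableEq m] [Fintype n] (M : Matrix m n ℂ) : ℝ :=
  scaledEntropy (M * Mᴴ) (isHermitian_mul_conjTranspose_self M)

theorem matrixEntropy_nonneg {m n : Type*} [Fintype m] [DecidableEq m] [Fintype n]
    (M : Matrix m n ℂ) : 0 ≤ matrixEntropy M :=
  scaledEntropy_nonneg (posSemidef_self_mul_conjTranspose M)

/-- Schmidt symmetry: `M * Mᴴ` and `Mᴴ * M` have the same characteristic polynomial up to powers of
`X`, so the entropy may be computed on either side. -/
theorem matrixEntropy_conjTranspose {m n : Type*} [Fintype m] [DecidableEq m] [Fintype n]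
    [DecidableEq n] (M : Matrix m n ℂ) : matrixEntropy Mᴴ = matrixEntropy M :=
  (scaledEntropy_congr (isHermitian_mul_conjTranspose_self Mᴴ)
    (isHermitian_mul_conjTranspose_self M) (a := Fintype.card m) (b := Fintype.card n) (by
      rw [conjTranspose_conjTranspose]; exact (charpoly_mul_comm' M Mᴴ).symm)).1

theorem matrixEntropy_eq_zero_of_subsingleton_left {m n : Type*} [Fintype m] [DecidableEq m]
    [Fintype n] (hm : Subsingleton m) (M : Matrix m n ℂ) : matrixEntropy M = 0 :=
  scaledEntropy_eq_zero_of_subsingleton hm _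

theorem matrixEntropy_eq_zero_of_subsingleton_right {m n : Type*} [Fintype m] [DecidableEq m]
    [Fintype n] (hn : Subsingleton n) (M : Matrix m n ℂ) : matrixEntropy M = 0 := by
  classical
  rw [← matrixEntropy_conjTranspose]
  exact matrixEntropy_eq_zero_of_subsingleton_left hn _

/-- Local isometries, here extensions of the coefficient matrix by zero, do not change the
entanglement. -/
theorem matrixEntropy_extend {m n m' n' : Type*} [Fintype m] [DecidableEq m] [Fintype n]
    [Fintype m'] [DecidableEq m'] [Fintype n'] {M : Matrix m n ℂ} {M' : Matrix m' n' ℂ}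
    {f : m → m'} {g : n → n'} (hf : f.Injective) (hg : g.Injective)
    (hM : ∀ x z, M' (f x) (g z) = M x z)
    (h0 : ∀ x z, x ∉ Set.range f ∨ z ∉ Set.range g → M' x z = 0) :
    matrixEntropy M' = matrixEntropy M ∧ (M' * M'ᴴ).trace.re = (M * Mᴴ).trace.re := by
  classical
  -- `V` is the isometry sending the basis vector `x` to `f x`. Then `M' * M'ᴴ = V * (M * Mᴴ) * Vᴴ`,
  -- and cyclicity of the characteristic polynomial with `Vᴴ * V = 1` removes `V`.
  set V : Matrix m' m ℂ := (1 : Matrix m' m' ℂ).submatrix id f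
  have hV : Vᴴ * V = 1 := by
    ext i j
    simp [V, Matrix.mul_apply, Matrix.one_apply, hf.eq_iff]
  have hfac : M' * M'ᴴ = V * (M * Mᴴ * Vᴴ) := by
    ext x y
    rw [Matrix.mul_apply]
    by_cases hx : x ∈ Set.range f
    · by_cases hy : y ∈ Set.range f
      · obtain ⟨x, rfl⟩ := hx
        obtain ⟨y, rfl⟩ := hy
        have e : (V * (M * Mᴴ * Vᴴ)) (f x) (f y) = (M * Mᴴ) x y := by
          simp [V, Matrix.mul_apply, Matrix.one_apply, hf.eq_iff]
        rw [e, Matrix.mul_apply]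
        symm
        refine Fintype.sum_of_injective g hg _ _ (fun z hz => ?_) fun z => ?_
        · rw [h0 _ _ (Or.inr hz), zero_mul]
        · simp [hM]
      · rw [Finset.sum_eq_zero fun z _ => by simp [h0 y z (Or.inl hy)]]
        have : ∀ i, f i ≠ y := fun i h => hy ⟨i, h⟩
        simp [V, Matrix.mul_apply, Matrix.one_apply, this]
    · rw [Finset.sum_eq_zero fun z _ => by simp [h0 x z (Or.inl hx)]]
      have : ∀ i, x ≠ f i := fun i h => hx ⟨i, h.symm⟩
      simp [V, Matrix.mul_apply, Matrix.one_apply, this]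
  refine scaledEntropy_congr (isHermitian_mul_conjTranspose_self M')
    (isHermitian_mul_conjTranspose_self M) (a := Fintype.card m) (b := Fintype.card m') ?_
  rw [hfac, charpoly_mul_comm', Matrix.mul_assoc (M * Mᴴ), hV, Matrix.mul_one]

/-- Measuring the column system splits the reduced operator of the row system: by completeness `M *
Mᴴ` is the sum of the `(M * L k) * (M * L k)ᴴ`, so concavity applies. -/
theorem sum_matrixEntropy_mul_right_le {m n κ : Type*} [Fintype m] [DecidableEq m] [Fintype n]
    [DecidableEq n] [Fintype κ] (M : Matrix m n ℂ) {L : κ → Matrix n n ℂ}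
    (hL : ∑ k, L k * (L k)ᴴ = 1) : ∑ k, matrixEntropy (M * L k) ≤ matrixEntropy M := by
  have := sum_scaledEntropy_le (isHermitian_mul_conjTranspose_self M)
    (σ := fun k => M * L k * (M * L k)ᴴ) (fun k => posSemidef_self_mul_conjTranspose (M * L k))
    (c := fun _ => 1) (fun _ => zero_le_one) (by
      simp_rw [conjTranspose_mul, Complex.ofReal_one, one_smul]
      have : ∀ k, M * L k * ((L k)ᴴ * Mᴴ) = M * (L k * (L k)ᴴ) * Mᴴ := fun k => by
        simp only [Matrix.mul_assoc]
      simp_rw [this]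
      rw [← Matrix.sum_mul, ← Matrix.mul_sum, hL, Matrix.mul_one])
  simpa [matrixEntropy] using this

theorem sum_matrixEntropy_mul_left_le {m n κ : Type*} [Fintype m] [DecidableEq m] [Fintype n]
    [Fintype κ] (M : Matrix m n ℂ) {L : κ → Matrix m m ℂ}
    (hL : ∑ k, (L k)ᴴ * L k = 1) : ∑ k, matrixEntropy (L k * M) ≤ matrixEntropy M := by
  classical
  have := sum_matrixEntropy_mul_right_le Mᴴ (L := fun k => (L k)ᴴ) (by simpa using hL)
  simp_rw [← conjTranspose_mul, matrixEntropy_conjTranspose] at this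
  exact this

/-- Concavity with a single summand of weight `|c|²`. Equality holds in fact, but only this
direction is needed at the end of a branch. -/
theorem matrixEntropy_smul_ge {m n : Type*} [Fintype m] [DecidableEq m] [Fintype n]
    (M : Matrix m n ℂ) (c : ℂ) :
    Complex.normSq c * matrixEntropy M ≤ matrixEntropy (c • M) := by
  have := sum_scaledEntropy_le (κ := Unit) (isHermitian_mul_conjTranspose_self (c • M))
    (σ := fun _ => M * Mᴴ) (fun _ => posSemidef_self_mul_conjTranspose M)
    (c := fun _ => Complex.normSq c) (fun _ => Complex.normSq_nonneg c) (by
      simp [conjTranspose_smul, smul_smul, Complex.normSq_eq_conj_mul_self])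
  simpa [matrixEntropy] using this

/-! ### Coefficient matrices of multipartite vectors -/

/-- The coefficients of `ψ` with respect to the bipartition of the parties into `A` and its
complement. -/
def coeffMatrix {N : ℕ} {D : Type} (A : Set (Fin N)) (ψ : MultiVec N D) :
    Matrix ({j // j ∈ A} → D) ({j // j ∉ A} → D) ℂ :=
  Matrix.of fun x z => ψ (glue A x z)

theorem glue_apply_mem {N : ℕ} {D : Type} {A : Set (Fin N)} (x : {j // j ∈ A} → D)
    (z : {j // j ∉ A} → D) {j : Fin N} (h : j ∈ A) : glue A x z j = x ⟨j, h⟩ := by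
  simp [glue, h]

theorem glue_apply_notMem {N : ℕ} {D : Type} {A : Set (Fin N)} (x : {j // j ∈ A} → D)
    (z : {j // j ∉ A} → D) {j : Fin N} (h : j ∉ A) : glue A x z j = z ⟨j, h⟩ := by
  simp [glue, h]

theorem glue_restrict {N : ℕ} {D : Type} (A : Set (Fin N)) (w : Fin N → D) :
    glue A (fun j => w j) (fun j => w j) = w := by
  funext j
  by_cases h : j ∈ A <;> simp [glue, h]

open Classical in
theorem sum_glue {N : ℕ} {D : Type} [Fintype D] (A : Set (Fin N)) (F : (Fin N → D) → ℝ) :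
    ∑ x, ∑ z, F (glue A x z) = ∑ w, F w := by
  rw [← Fintype.sum_prod_type']
  refine Fintype.sum_bijective (fun p : _ × _ => glue A p.1 p.2) ⟨?_, ?_⟩ _ _ fun _ => rfl
  · rintro ⟨x, z⟩ ⟨x', z'⟩ h
    have h' := fun j => congr_fun h j
    refine Prod.ext (funext fun j => ?_) (funext fun j => ?_)
    · simpa [glue_apply_mem _ _ j.2] using h' j
    · simpa [glue_apply_notMem _ _ j.2] using h' j
  · exact fun w => ⟨(fun j => w j, fun j => w j), glue_restrict A w⟩

open Classical in
theorem reducedDensity_eq {N : ℕ} {D : Type} [Fintype D] (A : Set (Fin N)) (ψ : MultiVec N D) :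
    reducedDensity A ψ = coeffMatrix A ψ * (coeffMatrix A ψ)ᴴ := by
  ext x y
  simp [reducedDensity, partialTrace, densityMatrix, coeffMatrix, Matrix.mul_apply]

open Classical in
theorem trace_coeffMatrix {N : ℕ} {D : Type} [Fintype D] (A : Set (Fin N)) (ψ : MultiVec N D) :
    (coeffMatrix A ψ * (coeffMatrix A ψ)ᴴ).trace.re = ‖ψ‖ ^ 2 := by
  rw [EuclideanSpace.norm_sq_eq, ← sum_glue A]
  simp [Matrix.trace, Matrix.mul_apply, coeffMatrix, Complex.mul_conj, ← Complex.normSq_eq_norm_sq]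

open Classical in
/-- The unnormalized entanglement entropy of `ψ`, in nats. -/
def vecEntropy {N : ℕ} {D : Type} [Fintype D] (A : Set (Fin N)) (ψ : MultiVec N D) : ℝ :=
  matrixEntropy (coeffMatrix A ψ)

theorem entanglementEntropy_eq {N : ℕ} {D : Type} [Fintype D] (A : Set (Fin N))
    {ψ : MultiVec N D} (hψ : ‖ψ‖ = 1) :
    entanglementEntropy A ψ = vecEntropy A ψ / Real.log 2 := by
  classical
  -- The term `log (Tr ρ)` vanishes for trace one. Stating this for arbitrary `ρ = σ` lets the
  -- equality be substituted although the Hermiticity proofs depend on the matrices.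
  have key : ∀ {ι : Type} [Fintype ι] [DecidableEq ι] (ρ σ : Matrix ι ι ℂ) (hρ : ρ.IsHermitian)
      (hσ : σ.IsHermitian), ρ = σ → σ.trace.re = 1 →
      vonNeumannEntropy ρ hρ = scaledEntropy σ hσ / Real.log 2 := by
    rintro ι _ _ ρ _ hρ hσ rfl h1
    rw [vonNeumannEntropy, scaledEntropy, h1, Finset.sum_div, ← Finset.sum_neg_distrib]
    refine Finset.sum_congr rfl fun i _ => ?_
    rw [Real.logb, Real.log_one]
    ring
  refine key _ _ _ _ (reducedDensity_eq A ψ) ?_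
  have := trace_coeffMatrix A ψ
  rw [hψ, one_pow] at this
  convert this

/-! ### Adding parties and ancillas in a fixed state -/

/-- A vector that is obtained from another one by adding parties in a fixed state, and ancillas in a
fixed state to the given parties, has the same norm and the same entanglement. -/
theorem vecEntropy_extend {n N : ℕ} {D D' : Type} [Fintype D] [Fintype D'] (F : Fin n ↪ Fin N)
    {e : D → D'} (he : e.Injective) (d : D') {φ : MultiVec n D} {ψ : MultiVec N D'}
    (h1 : ∀ x : Fin n → D, ψ (Function.extend F (e ∘ x) fun _ => d) = φ x)
    (h2 : ∀ y : Fin N → D', (∀ x : Fin n → D, y ≠ Function.extend F (e ∘ x) fun _ => d) → ψ y = 0)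
    (A : Set (Fin N)) :
    vecEntropy A ψ = vecEntropy (F ⁻¹' A) φ ∧ ‖ψ‖ = ‖φ‖ := by
  classical
  let FA : {k // k ∈ F ⁻¹' A} → {j // j ∈ A} := fun k => ⟨F k, k.2⟩
  let FB : {k // k ∉ F ⁻¹' A} → {j // j ∉ A} := fun k => ⟨F k, k.2⟩
  have hFA : FA.Injective := fun a b h => Subtype.ext (F.injective (congrArg Subtype.val h))
  have hFB : FB.Injective := fun a b h => Subtype.ext (F.injective (congrArg Subtype.val h))
  let f : ({k // k ∈ F ⁻¹' A} → D) → {j // j ∈ A} → D' :=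
    fun x => Function.extend FA (e ∘ x) fun _ => d
  let g : ({k // k ∉ F ⁻¹' A} → D) → {j // j ∉ A} → D' :=
    fun x => Function.extend FB (e ∘ x) fun _ => d
  have hf : f.Injective := fun x y h => funext fun k => he <| by
    have := congr_fun h (FA k)
    simpa [f, hFA.extend_apply] using this
  have hg : g.Injective := fun x y h => funext fun k => he <| by
    have := congr_fun h (FB k)
    simpa [g, hFB.extend_apply] using this
  have hglue : ∀ x z, glue A (f x) (g z) =
      Function.extend F (e ∘ glue (F ⁻¹' A) x z) fun _ => d := by
    intro x z
    funext j
    by_cases hj : ∃ k, F k = j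
    · obtain ⟨k, rfl⟩ := hj
      rw [F.injective.extend_apply]
      by_cases hA : F k ∈ A
      · rw [glue_apply_mem _ _ hA, Function.comp_apply,
          glue_apply_mem (A := F ⁻¹' A) _ _ (j := k) hA]
        exact hFA.extend_apply (e ∘ x) (fun _ => d) ⟨k, hA⟩
      · rw [glue_apply_notMem _ _ hA, Function.comp_apply,
          glue_apply_notMem (A := F ⁻¹' A) _ _ (j := k) hA]
        exact hFB.extend_apply (e ∘ z) (fun _ => d) ⟨k, hA⟩
    · rw [Function.extend_apply' _ _ _ hj]
      by_cases hA : j ∈ A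
      · rw [glue_apply_mem _ _ hA]
        exact Function.extend_apply' _ _ _ fun ⟨k, hk⟩ => hj ⟨k, congrArg Subtype.val hk⟩
      · rw [glue_apply_notMem _ _ hA]
        exact Function.extend_apply' _ _ _ fun ⟨k, hk⟩ => hj ⟨k, congrArg Subtype.val hk⟩
  -- A glued label comes from a label of the small system only if both halves do, so the coefficient
  -- matrix vanishes off the image of `f` and `g`.
  have hinv : ∀ x z w, glue A x z = (Function.extend F (e ∘ w) fun _ => d) →
      x ∈ Set.range f ∧ z ∈ Set.range g := by
    intro x z w h
    rw [← glue_restrict (F ⁻¹' A) w, ← hglue] at h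
    refine ⟨⟨fun k => w k, funext fun j => ?_⟩, ⟨fun k => w k, funext fun j => ?_⟩⟩
    · have := congr_fun h j
      rw [glue_apply_mem _ _ j.2, glue_apply_mem _ _ j.2] at this
      exact this.symm
    · have := congr_fun h j
      rw [glue_apply_notMem _ _ j.2, glue_apply_notMem _ _ j.2] at this
      exact this.symm
  have := matrixEntropy_extend (M := coeffMatrix (F ⁻¹' A) φ) (M' := coeffMatrix A ψ) hf hg
    (fun x z => by simp [coeffMatrix, hglue, h1]) (fun x z hxz => by
      refine h2 _ fun w hw => ?_
      obtain ⟨hx, hz⟩ := hinv x z w hw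
      exact hxz.elim (fun h => h hx) (fun h => h hz))
  refine ⟨this.1, ?_⟩
  have h3 := this.2
  rw [← sq_eq_sq₀ (norm_nonneg _) (norm_nonneg _), ← trace_coeffMatrix A ψ,
    ← trace_coeffMatrix (F ⁻¹' A) φ]
  convert h3

theorem vecEntropy_padZero {n N : ℕ} (F : Fin n ↪ Fin N) (φ : QubitVec n) (A : Set (Fin N)) :
    vecEntropy A (padZero F φ) = vecEntropy (F ⁻¹' A) φ ∧ ‖padZero F φ‖ = ‖φ‖ := by
  refine vecEntropy_extend F Function.injective_id 0 (fun x => ?_) (fun y hy => ?_) A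
  · have : ∀ j, j ∉ Set.range F → Function.extend F (id ∘ x) (fun _ => (0 : Fin 2)) j = 0 :=
      fun j hj => Function.extend_apply' _ _ _ hj
    rw [padZero, WithLp.ofLp_toLp, if_pos this]
    simp [F.injective.extend_apply]
  · rw [padZero, WithLp.ofLp_toLp, if_neg]
    intro h
    refine hy (fun k => y (F k)) (funext fun j => ?_)
    by_cases hj : j ∈ Set.range F
    · obtain ⟨k, rfl⟩ := hj
      simp [F.injective.extend_apply]
    · rw [h j hj, Function.extend_apply' _ _ _ hj]

theorem vecEntropy_withAncillas {N : ℕ} (a : ℕ) (ψ : QubitVec N) (A : Set (Fin N)) :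
    vecEntropy A (withAncillas a ψ) = vecEntropy A ψ ∧ ‖withAncillas a ψ‖ = ‖ψ‖ := by
  have hext : ∀ x : Fin N → Fin 2, (Function.extend (Function.Embedding.refl (Fin N))
      ((fun b => (b, (0 : Fin (a + 1)))) ∘ x) fun _ => (0, 0)) = fun j => (x j, 0) :=
    fun x => funext fun j => Function.injective_id.extend_apply _ _ j
  -- No party is added, so the filler `(0, 0)` never occurs; only the local basis is enlarged.
  refine vecEntropy_extend (Function.Embedding.refl (Fin N)) (e := fun b => (b, (0 : Fin (a + 1))))
    (fun x y h => (Prod.ext_iff.1 h).1) (0, 0) (fun x => ?_) (fun y hy => ?_) A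
  · rw [hext]
    simp [withAncillas]
  · rw [withAncillas, WithLp.ofLp_toLp, if_neg]
    intro h
    refine hy (fun j => (y j).1) ?_
    rw [hext]
    exact funext fun j => Prod.ext rfl (h j)

theorem entanglementEntropy_padZero {n N : ℕ} (F : Fin n ↪ Fin N) {φ : QubitVec n} (hφ : ‖φ‖ = 1)
    (A : Set (Fin N)) :
    entanglementEntropy A (padZero F φ) = entanglementEntropy (F ⁻¹' A) φ := by
  rw [entanglementEntropy_eq A ((vecEntropy_padZero F φ A).2.trans hφ), entanglementEntropy_eq _ hφ,
    (vecEntropy_padZero F φ A).1]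

theorem entanglementEntropy_nonneg {N : ℕ} {D : Type} [Fintype D] (A : Set (Fin N))
    {ψ : MultiVec N D} (hψ : ‖ψ‖ = 1) : 0 ≤ entanglementEntropy A ψ := by
  rw [entanglementEntropy_eq A hψ]
  classical
  exact div_nonneg (matrixEntropy_nonneg _) (Real.log_nonneg one_le_two)

theorem entanglementEntropy_eq_zero_of_eq_empty {N : ℕ} {D : Type} [Fintype D] {A : Set (Fin N)}
    (hA : A = ∅) {ψ : MultiVec N D} (hψ : ‖ψ‖ = 1) : entanglementEntropy A ψ = 0 := by
  have : IsEmpty {j : Fin N // j ∈ A} := ⟨fun j => (hA ▸ j.2 : j.1 ∈ (∅ : Set (Fin N)))⟩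
  have h : vecEntropy A ψ = 0 := by
    classical
    exact matrixEntropy_eq_zero_of_subsingleton_left ⟨fun x y => funext this.elim⟩ _
  rw [entanglementEntropy_eq _ hψ, h, zero_div]

theorem entanglementEntropy_eq_zero_of_eq_univ {N : ℕ} {D : Type} [Fintype D] {A : Set (Fin N)}
    (hA : A = Set.univ) {ψ : MultiVec N D} (hψ : ‖ψ‖ = 1) : entanglementEntropy A ψ = 0 := by
  have : IsEmpty {j : Fin N // j ∉ A} := ⟨fun j => j.2 (hA ▸ Set.mem_univ j.1)⟩
  have h : vecEntropy A ψ = 0 := by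
    classical
    exact matrixEntropy_eq_zero_of_subsingleton_right ⟨fun x y => funext this.elim⟩ _
  rw [entanglementEntropy_eq _ hψ, h, zero_div]

/-! ### Local operations -/

open Classical in
/-- The operator `K` on the factor `i`, tensored with the identity on the other factors. -/
def localOp {J D : Type} (i : J) (K : Matrix D D ℂ) : Matrix (J → D) (J → D) ℂ :=
  Matrix.of fun x y => if ∀ j, j ≠ i → x j = y j then K (x i) (y i) else 0

/-- Row `x` of `localOp i K` is supported on the labels that differ from `x` at most in position
`i`. -/
theorem sum_localOp_mul {J D : Type} [Fintype J] [DecidableEq J] [Fintype D] (i : J) (K : Matrix D D ℂ)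
    (x : J → D) (f : (J → D) → ℂ) :
    ∑ y, localOp i K x y * f y = ∑ k, K (x i) k * f (Function.update x i k) := by
  symm
  refine Fintype.sum_of_injective (fun k => Function.update x i k) (Function.update_injective x i)
    _ _ (fun y hy => ?_) (fun k => ?_)
  · rw [localOp, Matrix.of_apply, if_neg, zero_mul]
    intro h
    refine hy ⟨y i, funext fun j => ?_⟩
    by_cases hj : j = i
    · subst hj; simp
    · simp [Function.update_of_ne hj, h j hj]
  · rw [localOp, Matrix.of_apply, if_pos]
    · simp
    · intro j hj
      rw [Function.update_of_ne hj]

theorem localOp_mul {J D : Type} [Fintype J] [DecidableEq J] [Fintype D] (i : J) (K L : Matrix D D ℂ) :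
    localOp i K * localOp i L = localOp i (K * L) := by
  ext x y
  rw [Matrix.mul_apply, sum_localOp_mul]
  by_cases h : ∀ j, j ≠ i → x j = y j
  · have h' : ∀ k, ∀ j, j ≠ i → Function.update x i k j = y j := fun k j hj => by
      rw [Function.update_of_ne hj, h j hj]
    simp only [localOp, Matrix.of_apply, if_pos h, if_pos (h' _), Matrix.mul_apply,
      Function.update_self]
  · have h' : ∀ k, ¬ ∀ j, j ≠ i → Function.update x i k j = y j := fun k hk => h fun j hj => by
      rw [← hk j hj, Function.update_of_ne hj]
    simp only [localOp, Matrix.of_apply, if_neg h, if_neg (h' _), mul_zero, Finset.sum_const_zero]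

theorem localOp_conjTranspose {J D : Type} (i : J) (K : Matrix D D ℂ) :
    (localOp i K)ᴴ = localOp i Kᴴ := by
  ext x y
  by_cases h : ∀ j, j ≠ i → x j = y j
  · have h' : ∀ j, j ≠ i → y j = x j := fun j hj => (h j hj).symm
    simp only [localOp, Matrix.of_apply, conjTranspose_apply, if_pos h, if_pos h']
  · have h' : ¬ ∀ j, j ≠ i → y j = x j := fun h' => h fun j hj => (h' j hj).symm
    simp only [localOp, Matrix.of_apply, conjTranspose_apply, if_neg h, if_neg h', star_zero]

theorem sum_localOp_conjTranspose_mul {J D : Type} [Fintype J] [DecidableEq J] [Fintype D]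
    [DecidableEq D] [DecidableEq (J → D)] (i : J) {m : ℕ}
    {K : Fin m → Matrix D D ℂ} (hK : ∑ k, (K k)ᴴ * K k = 1) :
    ∑ k, (localOp i (K k))ᴴ * localOp i (K k) = 1 := by
  simp_rw [localOp_conjTranspose, localOp_mul]
  ext x y
  rw [Matrix.sum_apply]
  by_cases h : ∀ j, j ≠ i → x j = y j
  · simp only [localOp, Matrix.of_apply, if_pos h]
    rw [← Matrix.sum_apply, hK, Matrix.one_apply, Matrix.one_apply]
    refine if_congr ⟨fun h1 => funext fun j => ?_, fun h1 => congr_fun h1 i⟩ rfl rfl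
    by_cases hj : j = i
    · rw [hj, h1]
    · exact h j hj
  · simp only [localOp, Matrix.of_apply, if_neg h, Finset.sum_const_zero]
    rw [Matrix.one_apply_ne]
    rintro rfl
    exact h fun _ _ => rfl

theorem sum_matrixEntropy_localOp_mul_le {J D n : Type} [Fintype J] [DecidableEq J] [Fintype D]
    [DecidableEq D] [DecidableEq (J → D)] [Fintype n] (i : J) {m : ℕ}
    {K : Fin m → Matrix D D ℂ} (hK : ∑ k, (K k)ᴴ * K k = 1) (M : Matrix (J → D) n ℂ) :
    ∑ k, matrixEntropy (localOp i (K k) * M) ≤ matrixEntropy M :=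
  sum_matrixEntropy_mul_left_le M (sum_localOp_conjTranspose_mul i hK)

/-- Operators on the column side act by right multiplication with their transposes; the completeness
relation required there is the transpose of the given one. -/
theorem sum_matrixEntropy_mul_localOp_transpose_le {J D n : Type} [Fintype J] [DecidableEq J]
    [Fintype D] [DecidableEq D] [Fintype n] [DecidableEq n] (i : J) {m : ℕ}
    {K : Fin m → Matrix D D ℂ} (hK : ∑ k, (K k)ᴴ * K k = 1) (M : Matrix n (J → D) ℂ) :
    ∑ k, matrixEntropy (M * (localOp i (K k))ᵀ) ≤ matrixEntropy M := by
  refine sum_matrixEntropy_mul_right_le M ?_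
  have h := congrArg Matrix.transpose (sum_localOp_conjTranspose_mul i hK)
  rw [Matrix.transpose_sum, Matrix.transpose_one] at h
  rw [← h]
  refine Finset.sum_congr rfl fun k _ => ?_
  rw [Matrix.transpose_mul]
  rfl

theorem sum_trace_localOp_mul {J D n : Type} [Fintype J] [DecidableEq J] [Fintype D]
    [DecidableEq D] [Fintype n] (i : J) {m : ℕ}
    {K : Fin m → Matrix D D ℂ} (hK : ∑ k, (K k)ᴴ * K k = 1) (M : Matrix (J → D) n ℂ) :
    ∑ k, (localOp i (K k) * M * (localOp i (K k) * M)ᴴ).trace = (M * Mᴴ).trace := by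
  classical
  rw [Matrix.trace_mul_comm M, ← Matrix.mul_one Mᴴ, ← sum_localOp_conjTranspose_mul i hK,
    Matrix.mul_sum, Matrix.sum_mul, Matrix.trace_sum]
  refine Finset.sum_congr rfl fun k _ => ?_
  rw [Matrix.trace_mul_comm, Matrix.conjTranspose_mul]
  simp only [Matrix.mul_assoc]

open Classical in
theorem coeffMatrix_applyAt_mem {N : ℕ} {D : Type} [Fintype D] {A : Set (Fin N)} {i : Fin N}
    (hi : i ∈ A) (K : Matrix D D ℂ) (ψ : MultiVec N D) :
    coeffMatrix A (applyAt i K ψ) = localOp (⟨i, hi⟩ : {j // j ∈ A}) K * coeffMatrix A ψ := by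
  refine Matrix.ext fun x z => ?_
  rw [Matrix.mul_apply, sum_localOp_mul]
  simp only [coeffMatrix, applyAt, Matrix.of_apply, glue_apply_mem _ _ hi]
  refine Finset.sum_congr rfl fun k _ => ?_
  refine congrArg (fun w => K _ _ * ψ w) (funext fun j => ?_)
  by_cases hj : j = i
  · subst hj
    simp [glue_apply_mem _ _ hi]
  · rw [Function.update_of_ne hj]
    by_cases hA : j ∈ A
    · rw [glue_apply_mem _ _ hA, glue_apply_mem _ _ hA, Function.update_of_ne]
      exact fun h => hj (congrArg Subtype.val h)
    · rw [glue_apply_notMem _ _ hA, glue_apply_notMem _ _ hA]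

open Classical in
theorem coeffMatrix_applyAt_notMem {N : ℕ} {D : Type} [Fintype D] {A : Set (Fin N)} {i : Fin N}
    (hi : i ∉ A) (K : Matrix D D ℂ) (ψ : MultiVec N D) :
    coeffMatrix A (applyAt i K ψ) =
      coeffMatrix A ψ * (localOp (⟨i, hi⟩ : {j // j ∉ A}) K)ᵀ := by
  refine Matrix.ext fun x z => ?_
  simp_rw [Matrix.mul_apply, Matrix.transpose_apply, mul_comm (coeffMatrix A ψ x _)]
  rw [sum_localOp_mul]
  simp only [coeffMatrix, applyAt, Matrix.of_apply, glue_apply_notMem _ _ hi]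
  refine Finset.sum_congr rfl fun k _ => ?_
  refine congrArg (fun w => K _ _ * ψ w) (funext fun j => ?_)
  by_cases hj : j = i
  · subst hj
    simp [glue_apply_notMem _ _ hi]
  · rw [Function.update_of_ne hj]
    by_cases hA : j ∈ A
    · rw [glue_apply_mem _ _ hA, glue_apply_mem _ _ hA]
    · rw [glue_apply_notMem _ _ hA, glue_apply_notMem _ _ hA, Function.update_of_ne]
      exact fun h => hj (congrArg Subtype.val h)

open Classical in
/-- A local measurement does not increase the entanglement on average. -/
theorem sum_vecEntropy_applyAt_le {N : ℕ} {D : Type} [Fintype D] (A : Set (Fin N))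
    (i : Fin N) {m : ℕ} {K : Fin m → Matrix D D ℂ} (hK : ∑ k, (K k)ᴴ * K k = 1)
    (ψ : MultiVec N D) : ∑ k, vecEntropy A (applyAt i (K k) ψ) ≤ vecEntropy A ψ := by
  unfold vecEntropy
  by_cases hi : i ∈ A
  · simp_rw [coeffMatrix_applyAt_mem hi]
    exact sum_matrixEntropy_localOp_mul_le _ hK _
  · simp_rw [coeffMatrix_applyAt_notMem hi]
    exact sum_matrixEntropy_mul_localOp_transpose_le _ hK _

theorem sum_norm_sq_applyAt {N : ℕ} {D : Type} [Fintype D] [DecidableEq D] (i : Fin N) {m : ℕ}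
    {K : Fin m → Matrix D D ℂ} (hK : ∑ k, (K k)ᴴ * K k = 1) (ψ : MultiVec N D) :
    ∑ k, ‖applyAt i (K k) ψ‖ ^ 2 = ‖ψ‖ ^ 2 := by
  classical
  obtain ⟨A, hA⟩ : ∃ A : Set (Fin N), i ∈ A := ⟨Set.univ, trivial⟩
  simp_rw [← trace_coeffMatrix A, coeffMatrix_applyAt_mem hA]
  rw [← Complex.re_sum, sum_trace_localOp_mul _ hK]

theorem normSq_smul {N : ℕ} {D : Type} [Fintype D] (c : ℂ) {χ : MultiVec N D} (hχ : ‖χ‖ = 1) :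
    ‖c • χ‖ ^ 2 = Complex.normSq c := by
  rw [norm_smul, hχ, mul_one, Complex.normSq_eq_norm_sq]

/-- The factor `‖ψ‖ ^ 2` is the probability of having reached the current node. At a measurement
these probabilities add up while the weighted entropies do not increase in total, so the inequality
passes from the branches to their root. -/
theorem Protocol.Yields.vecEntropy_le {N : ℕ} {D : Type} [Fintype D] [DecidableEq D]
    (A : Set (Fin N)) {χ : MultiVec N D} (hχ : ‖χ‖ = 1) (P : Protocol N D) :
    ∀ ψ : MultiVec N D, P.Yields ψ χ → ‖ψ‖ ^ 2 * vecEntropy A χ ≤ vecEntropy A ψ := by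
  classical
  induction P with
  | stop_here =>
    rintro ψ ⟨c, rfl⟩
    rw [normSq_smul c hχ]
    exact matrixEntropy_smul_ge (coeffMatrix A χ) c
  | measure i m K hK next ih =>
    intro ψ h
    refine le_trans ?_ (sum_vecEntropy_applyAt_le A i (by convert hK) ψ)
    rw [← sum_norm_sq_applyAt i hK ψ, Finset.sum_mul]
    exact Finset.sum_le_sum fun k _ => ih k _ (h k)

/-- Deterministic LOCC conversion does not increase the entanglement entropy across any
bipartition. -/
theorem LOCCConvertible.entanglementEntropy_le {N : ℕ} {ψ χ : QubitVec N}
    (h : LOCCConvertible ψ χ) (hψ : ‖ψ‖ = 1) (hχ : ‖χ‖ = 1) (A : Set (Fin N)) :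
    entanglementEntropy A χ ≤ entanglementEntropy A ψ := by
  obtain ⟨a, P, hP⟩ := h
  have := Protocol.Yields.vecEntropy_le A ((vecEntropy_withAncillas a χ A).2.trans hχ) P _ hP
  rw [(vecEntropy_withAncillas a ψ A).2, (vecEntropy_withAncillas a ψ A).1,
    (vecEntropy_withAncillas a χ A).1, hψ, one_pow, one_mul] at this
  rw [entanglementEntropy_eq A hψ, entanglementEntropy_eq A hχ]
  exact div_le_div_of_nonneg_right this (Real.log_nonneg one_le_two)

/-! ### Cuts of graphs with a single crossing edge -/

/-- `S` contains `u` and not `w`, and no edge other than `uw` leaves `S`. -/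
structure IsCut {V : Type*} (G : SimpleGraph V) (u w : V) (S : Set V) : Prop where
  fst_mem : u ∈ S
  snd_notMem : w ∉ S
  eq_of_adj : ∀ x y, G.Adj x y → x ∈ S → y ∉ S → x = u ∧ y = w

theorem IsCut.compl {V : Type*} {G : SimpleGraph V} {u w : V} {S : Set V} (h : IsCut G u w S) :
    IsCut G w u Sᶜ :=
  ⟨h.snd_notMem, fun h' => h' h.fst_mem, fun x y hxy hx hy =>
    (h.eq_of_adj y x hxy.symm (not_not.1 hy) hx).symm⟩

theorem reachable_map_of_adj {V W : Type*} {G : SimpleGraph V} {H : SimpleGraph W} (r : V → W)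
    (h : ∀ x y, G.Adj x y → H.Reachable (r x) (r y)) {x y : V} (hxy : G.Reachable x y) :
    H.Reachable (r x) (r y) := by
  obtain ⟨p⟩ := hxy
  induction p with
  | nil => exact SimpleGraph.Reachable.refl _
  | cons hadj _ ih => exact (h _ _ hadj).trans ih

theorem prop_of_reachable {V : Type*} {G : SimpleGraph V} {P : V → Prop}
    (h : ∀ x y, G.Adj x y → P x → P y) {x y : V} (hxy : G.Reachable x y) (hx : P x) : P y := by
  obtain ⟨p⟩ := hxy
  induction p with
  | nil => exact hx
  | cons hadj _ ih => exact ih (h _ _ hadj hx)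

theorem adj_deleteEdges_singleton {V : Type*} {G : SimpleGraph V} {u w x y : V} :
    (G.deleteEdges {s(u, w)}).Adj x y ↔ G.Adj x y ∧ s(x, y) ≠ s(u, w) := by
  simp [SimpleGraph.deleteEdges_adj]

theorem IsCut.mem_of_reachable {V : Type*} {G : SimpleGraph V} {u w : V} {S : Set V}
    (h : IsCut G u w S) {x : V} (hx : (G.deleteEdges {s(u, w)}).Reachable u x) : x ∈ S := by
  refine prop_of_reachable (P := (· ∈ S)) (fun x y hxy hx => ?_) hx h.fst_mem
  rw [adj_deleteEdges_singleton] at hxy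
  by_contra hy
  obtain ⟨rfl, rfl⟩ := h.eq_of_adj x y hxy.1 hx hy
  exact hxy.2 rfl

/-- Along a walk in `G` starting at `u`, vertices in `S` stay linked to `u` and those outside to
`w`, since the only crossing edge is `uw`. Hence any cut found by hand is the component that defines
`SubcubicTree.side`. -/
theorem IsCut.reachable_iff {V : Type*} {G : SimpleGraph V} (hG : G.Preconnected) {u w : V}
    {S : Set V} (h : IsCut G u w S) (x : V) :
    (G.deleteEdges {s(u, w)}).Reachable u x ↔ x ∈ S := by
  refine ⟨h.mem_of_reachable, fun hx => ?_⟩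
  have key := prop_of_reachable (P := fun x =>
    (x ∈ S → (G.deleteEdges {s(u, w)}).Reachable u x) ∧
      (x ∉ S → (G.deleteEdges {s(u, w)}).Reachable w x)) (fun x y hxy ih => ?_) (hG u x)
    ⟨fun _ => SimpleGraph.Reachable.refl _, fun h' => absurd h.fst_mem h'⟩
  · exact key.1 hx
  · by_cases hx : x ∈ S <;> by_cases hy : y ∈ S
    · refine ⟨fun _ => (ih.1 hx).trans (SimpleGraph.Adj.reachable ?_), fun h' => absurd hy h'⟩
      refine adj_deleteEdges_singleton.2 ⟨hxy, fun he => h.snd_notMem ?_⟩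
      rcases Sym2.eq_iff.1 he with ⟨rfl, rfl⟩ | ⟨rfl, rfl⟩ <;> assumption
    · obtain ⟨rfl, rfl⟩ := h.eq_of_adj x y hxy hx hy
      exact ⟨fun h' => absurd h' hy, fun _ => SimpleGraph.Reachable.refl _⟩
    · obtain ⟨rfl, rfl⟩ := h.eq_of_adj y x hxy.symm hy hx
      exact ⟨fun _ => SimpleGraph.Reachable.refl _, fun h' => absurd hy h'⟩
    · refine ⟨fun h' => absurd h' hy, fun _ => (ih.2 hx).trans (SimpleGraph.Adj.reachable ?_)⟩
      refine adj_deleteEdges_singleton.2 ⟨hxy, fun he => ?_⟩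
      have := h.fst_mem
      rcases Sym2.eq_iff.1 he with ⟨rfl, rfl⟩ | ⟨rfl, rfl⟩ <;> contradiction

theorem exists_isCut {V : Type*} {G : SimpleGraph V} (hG : G.IsAcyclic) {u w : V}
    (huw : G.Adj u w) : ∃ S, IsCut G u w S := by
  have hb := SimpleGraph.isBridge_iff.1
    (SimpleGraph.isAcyclic_iff_forall_isBridge.1 hG (G.mem_edgeSet.2 huw))
  refine ⟨{x | (G.deleteEdges {s(u, w)}).Reachable u x}, SimpleGraph.Reachable.refl _, ?_, ?_⟩
  · exact fun h => hb h
  · intro x y hxy hx hy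
    by_cases he : s(x, y) = s(u, w)
    · rcases Sym2.eq_iff.1 he with h | ⟨_, rfl⟩
      · exact h
      · exact absurd (SimpleGraph.Reachable.refl _) hy
    · exact absurd (SimpleGraph.Reachable.trans hx
        (SimpleGraph.Adj.reachable (adj_deleteEdges_singleton.2 ⟨hxy, he⟩))) hy

/-- An edge that alone crosses a cut is a bridge. The cuts exhibited to compute the sides of a new
graph therefore prove acyclicity as well. -/
theorem isAcyclic_of_forall_exists_isCut {V : Type*} {G : SimpleGraph V}
    (h : ∀ u w, G.Adj u w → ∃ S, IsCut G u w S) : G.IsAcyclic := by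
  rw [SimpleGraph.isAcyclic_iff_forall_isBridge]
  intro e
  induction e with
  | _ u w =>
    intro he
    obtain ⟨S, hS⟩ := h u w (G.mem_edgeSet.1 he)
    exact SimpleGraph.isBridge_iff.2 fun hr => hS.snd_notMem (hS.mem_of_reachable hr)

/-! ### Subcubic trees -/

theorem SubcubicTree.side_eq {N : ℕ} (T : SubcubicTree N) (d : T.graph.Dart) {S : Set T.V}
    (hS : IsCut T.graph d.fst d.snd S) : T.side d = {i | (T.leaf i).1 ∈ S} := by
  ext i
  exact hS.reachable_iff T.isTree.connected.preconnected _

/-- Construction of a subcubic tree from a connected graph all of whose edges are unique crossing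
edges of cuts. -/
theorem exists_subcubicTree {N : ℕ} {V : Type} [Finite V] {G : SimpleGraph V} (hG : G.Connected)
    (hdeg : ∀ v : V, (G.neighborSet v).ncard = 1 ∨ (G.neighborSet v).ncard = 3)
    {leaf : Fin N → V} (hinj : leaf.Injective)
    (hleaf : ∀ v, (G.neighborSet v).ncard = 1 ↔ v ∈ Set.range leaf) {Q : Set (Fin N) → Prop}
    (hcut : ∀ u w, G.Adj u w → ∃ S, IsCut G u w S ∧ Q (leaf ⁻¹' S)) :
    ∃ T : SubcubicTree N, ∀ d : T.graph.Dart, Q (T.side d) := by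
  have hac := isAcyclic_of_forall_exists_isCut fun u w h => (hcut u w h).imp fun _ h => h.1
  let T : SubcubicTree N :=
    { V := V
      finite_V := ‹_›
      graph := G
      isTree := ⟨hG, hac⟩
      subcubic := hdeg
      leaf := Equiv.ofBijective (fun i => ⟨leaf i, (hleaf _).2 ⟨i, rfl⟩⟩)
        ⟨fun i j h => hinj (congrArg Subtype.val h), fun v => by
          obtain ⟨i, hi⟩ := (hleaf _).1 v.2
          exact ⟨i, Subtype.ext hi⟩⟩ }
  refine ⟨T, fun d => ?_⟩
  obtain ⟨S, hS, hQ⟩ := hcut d.fst d.snd d.adj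
  rw [T.side_eq d hS]
  exact hQ

theorem SubcubicTree.leaf_injective {N : ℕ} (T : SubcubicTree N) :
    Function.Injective fun i => (T.leaf i).1 :=
  fun _ _ h => T.leaf.injective (Subtype.ext h)

theorem SubcubicTree.ncard_eq_one_iff {N : ℕ} (T : SubcubicTree N) (v : T.V) :
    (T.graph.neighborSet v).ncard = 1 ↔ v ∈ Set.range fun i => (T.leaf i).1 := by
  constructor
  · intro h
    obtain ⟨i, hi⟩ := T.leaf.surjective ⟨v, h⟩
    exact ⟨i, congrArg Subtype.val hi⟩
  · rintro ⟨i, rfl⟩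
    exact (T.leaf i).2

theorem SubcubicTree.exists_cut_of_adj {N : ℕ} (T : SubcubicTree N) {u w : T.V}
    (h : T.graph.Adj u w) : ∃ S, IsCut T.graph u w S :=
  exists_isCut T.isTree.isAcyclic h

/-- A cut with unique crossing edge gives the side of an edge. -/
theorem SubcubicTree.exists_side_eq {N : ℕ} (T : SubcubicTree N) {u w : T.V} {S : Set T.V}
    (h : T.graph.Adj u w) (hS : IsCut T.graph u w S) :
    ∃ d : T.graph.Dart, T.side d = {i | (T.leaf i).1 ∈ S} :=
  ⟨⟨(u, w), h⟩, T.side_eq _ hS⟩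

theorem SubcubicTree.exists_relabel {N : ℕ} (T : SubcubicTree N) (σ : Equiv.Perm (Fin N)) :
    ∃ T' : SubcubicTree N, ∀ d' : T'.graph.Dart, ∃ d : T.graph.Dart,
      T'.side d' = σ ⁻¹' T.side d := by
  have := T.finite_V
  refine exists_subcubicTree T.isTree.connected T.subcubic
    (T.leaf_injective.comp σ.injective) (fun v => ?_) (Q := fun A => ∃ d, A = σ ⁻¹' T.side d)
    fun u w h => ?_
  · rw [T.ncard_eq_one_iff, σ.surjective.range_comp]
  · obtain ⟨S, hS⟩ := T.exists_cut_of_adj h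
    obtain ⟨d, hd⟩ := T.exists_side_eq h hS
    exact ⟨S, hS, d, by rw [hd]; rfl⟩

theorem nonempty_subcubicTree_two : Nonempty (SubcubicTree 2) := by
  have hn : ∀ v : Fin 2, ((⊤ : SimpleGraph (Fin 2)).neighborSet v).ncard = 1 := by
    intro v
    rw [Set.ncard_eq_one]
    refine ⟨v + 1, ?_⟩
    ext x
    fin_cases v <;> fin_cases x <;> simp
  have hcut : ∀ u w : Fin 2, (⊤ : SimpleGraph (Fin 2)).Adj u w → IsCut ⊤ u w {u} := by
    intro u w h
    refine ⟨rfl, fun h' => h (Set.mem_singleton_iff.1 h').symm, ?_⟩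
    rintro x y - rfl hy
    refine ⟨rfl, ?_⟩
    have h1 : x ≠ w := h
    have h2 : y ≠ x := hy
    omega
  obtain ⟨T, -⟩ := exists_subcubicTree (G := (⊤ : SimpleGraph (Fin 2)))
    SimpleGraph.connected_top (fun v => Or.inl (hn v)) (leaf := id) Function.injective_id
    (fun v => iff_of_true (hn v) ⟨v, rfl⟩) (Q := fun _ => True)
    (fun u w h => ⟨{u}, hcut u w h, trivial⟩)
  exact ⟨T⟩

/-! ### Inserting a leaf -/

/-- The graph `G` with the edge `pq` subdivided by the vertex `inr false`, to which the new leaf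
`inr true` is attached. -/
def attachLeaf {V : Type*} (G : SimpleGraph V) (p q : V) : SimpleGraph (V ⊕ Bool) where
  Adj
    | .inl x, .inl y => G.Adj x y ∧ s(x, y) ≠ s(p, q)
    | .inl x, .inr false => x = p ∨ x = q
    | .inr false, .inl x => x = p ∨ x = q
    | .inr b, .inr c => b ≠ c
    | _, _ => False
  symm := ⟨by
    rintro (x | _ | _) (y | _ | _) h
    · exact ⟨h.1.symm, fun he => h.2 (Sym2.eq_swap.trans he)⟩
    all_goals first | exact h | exact Ne.symm h⟩
  loopless := ⟨by
    rintro (x | _ | _) h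
    · exact G.loopless.irrefl x h.1
    · exact h rfl
    · exact h rfl⟩

theorem connected_attachLeaf {V : Type*} {G : SimpleGraph V} (hG : G.Connected) (p q : V) :
    (attachLeaf G p q).Connected := by
  have hp : (attachLeaf G p q).Adj (.inl p) (.inr false) := Or.inl rfl
  have hq : (attachLeaf G p q).Adj (.inl q) (.inr false) := Or.inr rfl
  have hl : (attachLeaf G p q).Adj (.inr false) (.inr true) := Bool.false_ne_true
  rw [SimpleGraph.connected_iff_exists_forall_reachable]
  refine ⟨.inl p, ?_⟩
  rintro (x | _ | _)
  · refine reachable_map_of_adj Sum.inl (fun x y hxy => ?_) (hG.preconnected p x)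
    by_cases he : s(x, y) = s(p, q)
    · rcases Sym2.eq_iff.1 he with ⟨rfl, rfl⟩ | ⟨rfl, rfl⟩
      · exact hp.reachable.trans hq.reachable.symm
      · exact hq.reachable.trans hp.reachable.symm
    · exact SimpleGraph.Adj.reachable (show (attachLeaf G p q).Adj _ _ from ⟨hxy, he⟩)
  · exact hp.reachable
  · exact hp.reachable.trans hl.reachable

/-- An end of the subdivided edge exchanges its other end for the subdividing vertex; all other old
vertices keep their neighbours. -/
theorem ncard_neighborSet_attachLeaf_inl {V : Type*} {G : SimpleGraph V} {p q : V}
    (h : G.Adj p q) (x : V) :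
    ((attachLeaf G p q).neighborSet (.inl x)).ncard = (G.neighborSet x).ncard := by
  rw [← Set.ncard_image_of_injective (G.neighborSet x) (Sum.inl_injective (β := Bool))]
  have hend : ∀ y, G.Adj x y → s(p, q) = s(x, y) →
      ((attachLeaf G p q).neighborSet (.inl x)).ncard =
        (Sum.inl '' G.neighborSet x : Set (V ⊕ Bool)).ncard := by
    intro y hxy he
    rw [← Set.ncard_exchange (s := (Sum.inl '' G.neighborSet x : Set (V ⊕ Bool)))
      (a := .inr false) (b := .inl y) (by simp) ⟨y, hxy, rfl⟩]
    congr 1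
    have hx : x = p ∨ x = q := by
      rcases Sym2.eq_iff.1 he with ⟨rfl, rfl⟩ | ⟨rfl, rfl⟩ <;> simp
    ext (z | _ | _)
    · simp only [SimpleGraph.mem_neighborSet, attachLeaf, he]
      simp
      intro hz
      have := hxy.ne
      grind
    · simpa [SimpleGraph.mem_neighborSet, attachLeaf] using hx
    · simp [SimpleGraph.mem_neighborSet, attachLeaf]
  by_cases hp : x = p
  · subst hp; exact hend q h rfl
  by_cases hq : x = q
  · subst hq; exact hend p h.symm Sym2.eq_swap
  congr 1
  ext (z | _ | _)
  · simp only [SimpleGraph.mem_neighborSet, attachLeaf]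
    simp [hp, hq]
  · simp [SimpleGraph.mem_neighborSet, attachLeaf, hp, hq]
  · simp [SimpleGraph.mem_neighborSet, attachLeaf]

theorem neighborSet_attachLeaf_false {V : Type*} (G : SimpleGraph V) (p q : V) :
    (attachLeaf G p q).neighborSet (.inr false) = {.inl p, .inl q, .inr true} := by
  ext (z | _ | _) <;> simp [SimpleGraph.mem_neighborSet, attachLeaf]

theorem neighborSet_attachLeaf_true {V : Type*} (G : SimpleGraph V) (p q : V) :
    (attachLeaf G p q).neighborSet (.inr true) = {.inr false} := by
  ext (z | _ | _) <;> simp [SimpleGraph.mem_neighborSet, attachLeaf]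

/-- Cuts of `attachLeaf G p q` at an end of the subdivided edge. -/
theorem IsCut.attachLeaf_inl {V : Type*} {G : SimpleGraph V} {p q x y : V} {S : Set V}
    (hS : IsCut G x y S) (he : s(x, y) = s(p, q)) :
    IsCut (attachLeaf G p q) (.inl x) (.inr false) (Sum.inl '' S) := by
  refine ⟨⟨x, hS.fst_mem, rfl⟩, by simp, ?_⟩
  rintro _ b hab ⟨a, ha, rfl⟩ hb
  rcases b with b | _ | _
  · have hb' : b ∉ S := fun h => hb ⟨b, h, rfl⟩
    obtain ⟨rfl, rfl⟩ := hS.eq_of_adj a b hab.1 ha hb'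
    exact absurd he hab.2
  · refine ⟨?_, rfl⟩
    have h1 : a ≠ y := fun h => hS.snd_notMem (h ▸ ha)
    have h2 : a = p ∨ a = q := hab
    grind
  · exact hab.elim

/-- For an edge other than `pq`, both `p` and `q` lie on one side of the cut, and the two new
vertices join them there. -/
theorem IsCut.attachLeaf_inl_inl {V : Type*} {G : SimpleGraph V} {p q x y : V} {S : Set V}
    (hpq : G.Adj p q) (hS : IsCut G x y S) (he : s(x, y) ≠ s(p, q)) :
    IsCut (attachLeaf G p q) (.inl x) (.inl y) {z | Sum.elim (· ∈ S) (fun _ => p ∈ S) z} := by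
  have h1 : p ∈ S → q ∈ S := fun hp => by
    by_contra hq
    obtain ⟨rfl, rfl⟩ := hS.eq_of_adj p q hpq hp hq
    exact he rfl
  have h2 : q ∈ S → p ∈ S := fun hq => by
    by_contra hp
    obtain ⟨rfl, rfl⟩ := hS.eq_of_adj q p hpq.symm hq hp
    exact he Sym2.eq_swap
  refine ⟨hS.fst_mem, hS.snd_notMem, ?_⟩
  rintro (a | _ | _) (b | _ | _) hab ha hb
  · obtain ⟨rfl, rfl⟩ := hS.eq_of_adj a b hab.1 ha hb
    exact ⟨rfl, rfl⟩
  · rcases hab with rfl | rfl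
    · exact absurd ha hb
    · exact absurd (h2 ha) hb
  · exact hab.elim
  · rcases hab with rfl | rfl
    · exact absurd ha hb
    · exact absurd (h1 ha) hb
  · exact absurd ha hb
  · exact absurd ha hb
  · exact hab.elim
  · exact absurd ha hb
  · exact absurd ha hb

theorem isCut_attachLeaf_true {V : Type*} (G : SimpleGraph V) (p q : V) :
    IsCut (attachLeaf G p q) (.inr true) (.inr false) {.inr true} := by
  refine ⟨rfl, by simp, ?_⟩
  rintro _ b hab rfl hb
  have : b ∈ (attachLeaf G p q).neighborSet (.inr true) := hab
  rw [neighborSet_attachLeaf_true] at this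
  exact ⟨rfl, this⟩

/-- Each half of the subdivided edge restricts to a cut of `pq`, every other old edge keeps its cut,
and only the edge to the new leaf is trivial on the old vertices. -/
theorem exists_isCut_attachLeaf {V : Type*} {G : SimpleGraph V} (hG : G.IsAcyclic) {p q : V}
    (hpq : G.Adj p q) (x y : V ⊕ Bool) (hxy : (attachLeaf G p q).Adj x y) :
    ∃ S, IsCut (attachLeaf G p q) x y S ∧ (Sum.inl ⁻¹' S = ∅ ∨ Sum.inl ⁻¹' S = Set.univ ∨
      ∃ u w, G.Adj u w ∧ IsCut G u w (Sum.inl ⁻¹' S)) := by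
  have hend : ∀ x, (x = p ∨ x = q) → ∃ y S, G.Adj x y ∧ IsCut G x y S ∧ s(x, y) = s(p, q) := by
    rintro x (rfl | rfl)
    · obtain ⟨S, hS⟩ := exists_isCut hG hpq
      exact ⟨q, S, hpq, hS, rfl⟩
    · obtain ⟨S, hS⟩ := exists_isCut hG hpq.symm
      exact ⟨p, S, hpq.symm, hS, Sym2.eq_swap⟩
  have hpre : ∀ S : Set V, Sum.inl ⁻¹' (Sum.inl '' S : Set (V ⊕ Bool)) = S :=
    fun S => Set.preimage_image_eq S Sum.inl_injective
  rcases x with x | _ | _ <;> rcases y with y | _ | _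
  · obtain ⟨S, hS⟩ := exists_isCut hG hxy.1
    exact ⟨_, hS.attachLeaf_inl_inl hpq hxy.2, Or.inr (Or.inr ⟨x, y, hxy.1, hS⟩)⟩
  · obtain ⟨y, S, hxy, hS, he⟩ := hend x hxy
    exact ⟨_, hS.attachLeaf_inl he, Or.inr (Or.inr ⟨x, y, hxy, by rwa [hpre]⟩)⟩
  · exact hxy.elim
  · obtain ⟨x, S, hxy, hS, he⟩ := hend y hxy
    refine ⟨_, (hS.attachLeaf_inl he).compl, Or.inr (Or.inr ⟨x, y, hxy.symm, ?_⟩)⟩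
    rw [Set.preimage_compl, hpre]
    exact hS.compl
  · exact absurd rfl hxy
  · refine ⟨_, (isCut_attachLeaf_true G p q).compl, Or.inr (Or.inl ?_)⟩
    ext z; simp
  · exact hxy.elim
  · refine ⟨_, isCut_attachLeaf_true G p q, Or.inl ?_⟩
    ext z; simp
  · exact absurd rfl hxy

/-- A leaf can be added to a subcubic tree without introducing essentially new bipartitions. -/
theorem SubcubicTree.exists_insertLeaf {N : ℕ} (hN : 0 < N) (T : SubcubicTree N) :
    ∃ T' : SubcubicTree (N + 1), ∀ d' : T'.graph.Dart,
      Fin.castSucc ⁻¹' T'.side d' = ∅ ∨ Fin.castSucc ⁻¹' T'.side d' = Set.univ ∨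
        ∃ d : T.graph.Dart, Fin.castSucc ⁻¹' T'.side d' = T.side d := by
  have := T.finite_V
  -- Any edge could be subdivided; the one at leaf `0` is at hand.
  set p := (T.leaf ⟨0, hN⟩).1
  obtain ⟨q, hq⟩ := Set.ncard_eq_one.1 (T.leaf ⟨0, hN⟩).2
  have hpq : T.graph.Adj p q := by
    have : q ∈ T.graph.neighborSet p := by rw [hq]; rfl
    exact this
  have h3 : ((attachLeaf T.graph p q).neighborSet (.inr false)).ncard = 3 := by
    rw [neighborSet_attachLeaf_false, Set.ncard_eq_three]
    exact ⟨_, _, _, fun h => hpq.ne (Sum.inl_injective h), by simp, by simp, rfl⟩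
  have h1 : ((attachLeaf T.graph p q).neighborSet (.inr true)).ncard = 1 := by
    rw [neighborSet_attachLeaf_true, Set.ncard_singleton]
  let leaf : Fin (N + 1) → T.V ⊕ Bool :=
    Fin.lastCases (.inr true) fun i => .inl (T.leaf i).1
  have hl1 : leaf (Fin.last N) = .inr true := Fin.lastCases_last
  have hl2 : ∀ i : Fin N, leaf i.castSucc = .inl (T.leaf i).1 := fun i => Fin.lastCases_castSucc i
  refine exists_subcubicTree (connected_attachLeaf T.isTree.connected p q) ?_ (leaf := leaf) ?_ ?_
    (Q := fun A => Fin.castSucc ⁻¹' A = ∅ ∨ Fin.castSucc ⁻¹' A = Set.univ ∨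
      ∃ d : T.graph.Dart, Fin.castSucc ⁻¹' A = T.side d) ?_
  · rintro (x | _ | _)
    · rw [ncard_neighborSet_attachLeaf_inl hpq]
      exact T.subcubic x
    · exact Or.inr h3
    · exact Or.inl h1
  · intro i j
    induction i using Fin.lastCases <;> induction j using Fin.lastCases
    · simp
    · simp [hl1, hl2]
    · simp [hl1, hl2]
    · rw [hl2, hl2]
      intro h
      rw [T.leaf_injective (Sum.inl_injective h)]
  · rintro (x | _ | _)
    · rw [ncard_neighborSet_attachLeaf_inl hpq, T.ncard_eq_one_iff]
      constructor
      · rintro ⟨i, rfl⟩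
        exact ⟨_, hl2 i⟩
      · rintro ⟨i, hi⟩
        induction i using Fin.lastCases with
        | last => simp [hl1] at hi
        | cast i => rw [hl2] at hi; exact ⟨i, Sum.inl_injective hi⟩
    · rw [h3]
      refine iff_of_false (by norm_num) ?_
      rintro ⟨i, hi⟩
      induction i using Fin.lastCases with
      | last => simp [hl1] at hi
      | cast i => simp [hl2] at hi
    · exact iff_of_true h1 ⟨_, hl1⟩
  · intro u w huw
    obtain ⟨S, hS, h⟩ := exists_isCut_attachLeaf T.isTree.isAcyclic hpq u w huw
    have hpre : Fin.castSucc ⁻¹' (leaf ⁻¹' S) = {i | (T.leaf i).1 ∈ (Sum.inl ⁻¹' S : Set T.V)} := by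
      ext i
      simp [hl2]
    refine ⟨S, hS, ?_⟩
    rw [hpre]
    rcases h with h | h | ⟨x, y, hxy, h⟩
    · left; rw [h]; rfl
    · right; left; rw [h]; rfl
    · right; right
      obtain ⟨d, hd⟩ := T.exists_side_eq hxy h
      exact ⟨d, hd.symm⟩

theorem nonempty_subcubicTree {N : ℕ} (hN : 2 ≤ N) : Nonempty (SubcubicTree N) := by
  induction N, hN using Nat.le_induction with
  | base => exact nonempty_subcubicTree_two
  | succ N hN ih =>
    obtain ⟨T⟩ := ih
    obtain ⟨T', -⟩ := T.exists_insertLeaf (by omega)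
    exact ⟨T'⟩

/-! ### Deleting a leaf -/

/-- The graph `G` without the vertices `l` and `v` and with a new edge `ab`. -/
def suppressLeaf {V : Type*} (G : SimpleGraph V) (l v : V) {a b : V} (hab : a ≠ b) :
    SimpleGraph {x : V // x ≠ l ∧ x ≠ v} where
  Adj x y := G.Adj x y ∨ (x.1 = a ∧ y.1 = b) ∨ (x.1 = b ∧ y.1 = a)
  symm := ⟨by
    rintro x y (h | h | h)
    · exact Or.inl h.symm
    · exact Or.inr (Or.inr h.symm)
    · exact Or.inr (Or.inl h.symm)⟩
  loopless := ⟨by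
    rintro x (h | ⟨h1, h2⟩ | ⟨h1, h2⟩)
    · exact G.loopless.irrefl _ h
    · exact hab (h1.symm.trans h2)
    · exact hab (h2.symm.trans h1)⟩

section SuppressLeaf

variable {V : Type*} {G : SimpleGraph V} {l v a b : V}

theorem connected_suppressLeaf (hG : G.Connected) (hab : a ≠ b) (hl : G.neighborSet l = {v})
    (hv : G.neighborSet v = {l, a, b}) (ha : a ≠ l ∧ a ≠ v) :
    (suppressLeaf G l v hab).Connected := by
  classical
  have hl' : ∀ x, G.Adj l x → x = v := fun x hx => by
    have : x ∈ G.neighborSet l := hx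
    rwa [hl] at this
  have hv' : ∀ x, G.Adj v x → x = l ∨ x = a ∨ x = b := fun x hx => by
    have : x ∈ G.neighborSet v := hx
    rwa [hv] at this
  -- Retraction that collapses the two deleted vertices onto `a`. Each edge of `G` goes to a point,
  -- an old edge or the new edge `ab`, so connectedness is inherited.
  let r : V → {x : V // x ≠ l ∧ x ≠ v} := fun x => if h : x ≠ l ∧ x ≠ v then ⟨x, h⟩ else ⟨a, ha⟩
  have hr1 : ∀ x (h : x ≠ l ∧ x ≠ v), r x = ⟨x, h⟩ := fun x h => dif_pos h
  have hrl : r l = ⟨a, ha⟩ := dif_neg (by simp)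
  have hrv : r v = ⟨a, ha⟩ := dif_neg (by simp)
  have hlv : ∀ x y, G.Adj x y → x = l ∨ x = v →
      (suppressLeaf G l v hab).Reachable (r x) (r y) := by
    rintro x y hxy (rfl | rfl)
    · rw [hl' y hxy, hrl, hrv]
    · rcases hv' y hxy with h | h | h
      · rw [h, hrv, hrl]
      · rw [h, hrv, hr1 a ha]
      · subst h
        by_cases hb : y ≠ l ∧ y ≠ x
        · rw [hrv, hr1 y hb]
          exact SimpleGraph.Adj.reachable
            (show (suppressLeaf G l x hab).Adj _ _ from Or.inr (Or.inl ⟨rfl, rfl⟩))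
        · rw [hrv, show r y = _ from dif_neg hb]
  have hmap : ∀ x y, G.Adj x y → (suppressLeaf G l v hab).Reachable (r x) (r y) := by
    intro x y hxy
    by_cases hx : x = l ∨ x = v
    · exact hlv x y hxy hx
    · by_cases hy : y = l ∨ y = v
      · exact (hlv y x hxy.symm hy).symm
      · push Not at hx hy
        rw [hr1 x hx, hr1 y hy]
        exact SimpleGraph.Adj.reachable
          (show (suppressLeaf G l v hab).Adj _ _ from Or.inl hxy)
  rw [SimpleGraph.connected_iff_exists_forall_reachable]
  refine ⟨⟨a, ha⟩, fun x => ?_⟩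
  have := reachable_map_of_adj r hmap (hG.preconnected a x)
  rwa [hr1 a ha, hr1 x x.2] at this

theorem suppressLeaf_comm (hab : a ≠ b) :
    suppressLeaf G l v hab = suppressLeaf G l v hab.symm := by
  ext x y
  exact or_congr_right or_comm

theorem ncard_neighborSet_suppressLeaf_end (hG : G.IsAcyclic) (hab : a ≠ b)
    (hl : G.neighborSet l = {v}) (hv : G.neighborSet v = {l, a, b}) (ha : a ≠ l ∧ a ≠ v)
    (hb : b ≠ l ∧ b ≠ v) :
    ((suppressLeaf G l v hab).neighborSet ⟨a, ha⟩).ncard = (G.neighborSet a).ncard := by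
  have hva : G.Adj v a := show a ∈ G.neighborSet v by rw [hv]; simp
  have hvb : G.Adj v b := show b ∈ G.neighborSet v by rw [hv]; simp
  -- Otherwise `a`, `b`, `v` would form a triangle. Hence `b` is a new neighbour of `a`, and it
  -- replaces `v`.
  have hnab : ¬ G.Adj a b := fun h => by
    obtain ⟨S, hS⟩ := exists_isCut hG h
    by_cases hvS : v ∈ S
    · exact hva.ne (hS.eq_of_adj v b hvb hvS hS.snd_notMem).1
    · exact hvb.ne (hS.eq_of_adj a v hva.symm hS.fst_mem hvS).2
  have hal : ¬ G.Adj a l := fun h => by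
    have : a ∈ G.neighborSet l := h.symm
    rw [hl] at this
    exact ha.2 this
  rw [← Set.ncard_image_of_injective _ Subtype.val_injective,
    ← Set.ncard_exchange (s := G.neighborSet a) (a := b) (b := v) hnab hva.symm]
  congr 1
  ext x
  simp only [Set.mem_image, SimpleGraph.mem_neighborSet, Set.mem_insert_iff, Set.mem_sdiff,
    Set.mem_singleton_iff]
  constructor
  · rintro ⟨y, h | h | h, rfl⟩
    · exact Or.inr ⟨h, y.2.2⟩
    · exact Or.inl h.2
    · exact absurd h.1 hab
  · rintro (rfl | ⟨h, hxv⟩)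
    · exact ⟨⟨x, hb⟩, Or.inr (Or.inl ⟨rfl, rfl⟩), rfl⟩
    · exact ⟨⟨x, fun hxl => hal (hxl ▸ h), hxv⟩, Or.inl h, rfl⟩

theorem ncard_neighborSet_suppressLeaf (hG : G.IsAcyclic) (hab : a ≠ b)
    (hl : G.neighborSet l = {v}) (hv : G.neighborSet v = {l, a, b}) (ha : a ≠ l ∧ a ≠ v)
    (hb : b ≠ l ∧ b ≠ v) (x : {x : V // x ≠ l ∧ x ≠ v}) :
    ((suppressLeaf G l v hab).neighborSet x).ncard = (G.neighborSet x.1).ncard := by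
  by_cases hxa : x.1 = a
  · obtain ⟨x, hx⟩ := x
    subst hxa
    exact ncard_neighborSet_suppressLeaf_end hG hab hl hv ha hb
  by_cases hxb : x.1 = b
  · obtain ⟨x, hx⟩ := x
    subst hxb
    rw [suppressLeaf_comm]
    exact ncard_neighborSet_suppressLeaf_end hG hab.symm hl (by rw [hv, Set.pair_comm]) hb ha
  rw [← Set.ncard_image_of_injective _ Subtype.val_injective]
  congr 1
  ext y
  simp only [Set.mem_image, SimpleGraph.mem_neighborSet]
  constructor
  · rintro ⟨y, h | h | h, rfl⟩
    · exact h
    · exact absurd h.1 hxa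
    · exact absurd h.1 hxb
  · intro h
    refine ⟨⟨y, ?_, ?_⟩, Or.inl h, rfl⟩
    · rintro rfl
      have : x.1 ∈ G.neighborSet y := h.symm
      rw [hl] at this
      exact x.2.2 this
    · rintro rfl
      have : x.1 ∈ G.neighborSet y := h.symm
      rw [hv] at this
      rcases this with h | h | h
      · exact x.2.1 h
      · exact hxa h
      · exact hxb h

/-- The new edge `ab` inherits the cut of `av`: if `b` were in `S`, then `bv` would be a second
crossing edge. -/
theorem IsCut.suppressLeaf_end (hab : a ≠ b) (hv : G.neighborSet v = {l, a, b})
    (ha : a ≠ l ∧ a ≠ v) (hb : b ≠ l ∧ b ≠ v) {S : Set V} (hS : IsCut G a v S) :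
    IsCut (suppressLeaf G l v hab) ⟨a, ha⟩ ⟨b, hb⟩ (Subtype.val ⁻¹' S) := by
  have hvb : G.Adj v b := show b ∈ G.neighborSet v by rw [hv]; simp
  have hbS : b ∉ S := fun h => hab (hS.eq_of_adj b v hvb.symm h hS.snd_notMem).1.symm
  refine ⟨hS.fst_mem, hbS, ?_⟩
  rintro x y (h | h | h) hx hy
  · exact absurd (hS.eq_of_adj _ _ h hx hy).2 y.2.2
  · exact ⟨Subtype.ext h.1, Subtype.ext h.2⟩
  · exact absurd (h.1 ▸ hx : b ∈ S) hbS

theorem exists_isCut_suppressLeaf (hG : G.IsAcyclic) (hab : a ≠ b)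
    (hv : G.neighborSet v = {l, a, b}) (ha : a ≠ l ∧ a ≠ v) (hb : b ≠ l ∧ b ≠ v)
    (x y : {x : V // x ≠ l ∧ x ≠ v}) (hxy : (suppressLeaf G l v hab).Adj x y) :
    ∃ u w S, G.Adj u w ∧ IsCut G u w S ∧ IsCut (suppressLeaf G l v hab) x y (Subtype.val ⁻¹' S) := by
  have hva : G.Adj v a := show a ∈ G.neighborSet v by rw [hv]; simp
  have hvb : G.Adj v b := show b ∈ G.neighborSet v by rw [hv]; simp
  rcases hxy with h | ⟨h1, h2⟩ | ⟨h1, h2⟩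
  · obtain ⟨S, hS⟩ := exists_isCut hG h
    refine ⟨x, y, S, h, hS, hS.fst_mem, hS.snd_notMem, ?_⟩
    -- Neighbours of `v` lie on the same side: otherwise an edge at `v` would cross, making `v` an
    -- end of the surviving edge `xy`. So the added edge `ab` does not cross.
    have hcross : ∀ c d, G.Adj v c → G.Adj v d → c ∈ S → d ∈ S := by
      intro c d hc hd hcS
      by_contra hdS
      by_cases hvS : v ∈ S
      · exact x.2.2 (hS.eq_of_adj v d hd hvS hdS).1.symm
      · exact y.2.2 (hS.eq_of_adj c v hc.symm hcS hvS).2.symm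
    rintro x' y' (h' | ⟨h1, h2⟩ | ⟨h1, h2⟩) hx hy
    · obtain ⟨h1, h2⟩ := hS.eq_of_adj _ _ h' hx hy
      exact ⟨Subtype.ext h1, Subtype.ext h2⟩
    · exact absurd (h2 ▸ hcross a b hva hvb (h1 ▸ hx) : y'.1 ∈ S) hy
    · exact absurd (h2 ▸ hcross b a hvb hva (h1 ▸ hx) : y'.1 ∈ S) hy
  · obtain ⟨S, hS⟩ := exists_isCut hG hva.symm
    obtain rfl : x = ⟨a, ha⟩ := Subtype.ext h1
    obtain rfl : y = ⟨b, hb⟩ := Subtype.ext h2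
    exact ⟨a, v, S, hva.symm, hS, hS.suppressLeaf_end hab hv ha hb⟩
  · obtain ⟨S, hS⟩ := exists_isCut hG hvb.symm
    obtain rfl : x = ⟨b, hb⟩ := Subtype.ext h1
    obtain rfl : y = ⟨a, ha⟩ := Subtype.ext h2
    refine ⟨b, v, S, hvb.symm, hS, ?_⟩
    rw [suppressLeaf_comm]
    exact hS.suppressLeaf_end hab.symm (by rw [hv, Set.pair_comm]) hb ha

end SuppressLeaf

/-- In a subcubic tree with at least three leaves, the neighbour of a leaf has degree three. -/
theorem SubcubicTree.exists_neighbors {N : ℕ} (hN : 3 ≤ N) (T : SubcubicTree N) (i : Fin N) :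
    ∃ v a b, a ≠ b ∧ T.graph.neighborSet (T.leaf i).1 = {v} ∧
      T.graph.neighborSet v = {(T.leaf i).1, a, b} ∧
      (a ≠ (T.leaf i).1 ∧ a ≠ v) ∧ (b ≠ (T.leaf i).1 ∧ b ≠ v) := by
  have := T.finite_V
  set l := (T.leaf i).1
  obtain ⟨v, hv⟩ := Set.ncard_eq_one.1 (T.leaf i).2
  have hlv : T.graph.Adj l v := by
    have : v ∈ T.graph.neighborSet l := by rw [hv]; rfl
    exact this
  have h3 : (T.graph.neighborSet v).ncard = 3 := by
    refine (T.subcubic v).resolve_left fun h1 => ?_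
    obtain ⟨w, hw⟩ := Set.ncard_eq_one.1 h1
    have hlw : l = w := by
      have : l ∈ T.graph.neighborSet v := hlv.symm
      rwa [hw] at this
    -- If `v` too had degree one, the edge `lv` would be the whole tree, leaving room for at most
    -- two leaves.
    have hall : ∀ x, x = l ∨ x = v := fun x => by
      refine prop_of_reachable (P := fun x => x = l ∨ x = v) ?_
        (T.isTree.connected.preconnected l x) (Or.inl rfl)
      rintro x y hxy (rfl | rfl)
      · have : y ∈ T.graph.neighborSet l := hxy
        rw [hv] at this
        exact Or.inr this
      · have : y ∈ T.graph.neighborSet x := hxy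
        rw [hw, ← hlw] at this
        exact Or.inl this
    have hle := Set.ncard_le_ncard (s := Set.range fun i => (T.leaf i).1) (t := {l, v})
      (fun x _ => hall x)
    rw [← Set.image_univ, Set.ncard_image_of_injective _ T.leaf_injective, Set.ncard_univ,
      Nat.card_eq_fintype_card, Fintype.card_fin] at hle
    have := Set.ncard_pair hlv.ne
    omega
  have hmem : l ∈ T.graph.neighborSet v := hlv.symm
  have h2 : (T.graph.neighborSet v \ {l}).ncard = 2 := by
    rw [Set.ncard_sdiff_singleton_of_mem hmem, h3]
  obtain ⟨a, b, hab, hset⟩ := Set.ncard_eq_two.1 h2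
  have ha : a ∈ T.graph.neighborSet v \ {l} := by rw [hset]; simp
  have hb : b ∈ T.graph.neighborSet v \ {l} := by rw [hset]; simp
  refine ⟨v, a, b, hab, hv, ?_, ⟨ha.2, fun h => ?_⟩, ⟨hb.2, fun h => ?_⟩⟩
  · rw [← hset, Set.insert_sdiff_singleton, Set.insert_eq_of_mem hmem]
  · exact T.graph.loopless.irrefl v (h ▸ ha.1 : T.graph.Adj v v)
  · exact T.graph.loopless.irrefl v (h ▸ hb.1 : T.graph.Adj v v)

/-- A leaf of a subcubic tree can be deleted, and the bipartitions of the new tree are restrictions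
of those of the given one. -/
theorem SubcubicTree.exists_deleteLeaf {N : ℕ} (hN : 2 ≤ N) (T : SubcubicTree (N + 1))
    (i : Fin (N + 1)) :
    ∃ T' : SubcubicTree N, ∀ d' : T'.graph.Dart, ∃ d : T.graph.Dart,
      T'.side d' = i.succAbove ⁻¹' T.side d := by
  have := T.finite_V
  obtain ⟨v, a, b, hab, hl, hv, ha, hb⟩ := T.exists_neighbors (by omega) i
  have hac := T.isTree.isAcyclic
  have hcard := ncard_neighborSet_suppressLeaf hac hab hl hv ha hb
  have hv3 : (T.graph.neighborSet v).ncard = 3 := by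
    rw [hv, Set.ncard_eq_three]
    exact ⟨_, _, _, ha.1.symm, hb.1.symm, hab, rfl⟩
  let leaf : Fin N → {x : T.V // x ≠ (T.leaf i).1 ∧ x ≠ v} := fun j =>
    ⟨(T.leaf (i.succAbove j)).1, fun h => Fin.succAbove_ne i j (T.leaf_injective h), fun h => by
      have := (T.leaf (i.succAbove j)).2
      rw [h, hv3] at this
      omega⟩
  refine exists_subcubicTree (connected_suppressLeaf T.isTree.connected hab hl hv ha) ?_
    (leaf := leaf) ?_ ?_ (Q := fun A => ∃ d, A = i.succAbove ⁻¹' T.side d) ?_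
  · intro x
    rw [hcard]
    exact T.subcubic x
  · intro j k h
    exact Fin.succAbove_right_injective (T.leaf_injective (congrArg (fun x => x.1) h))
  · intro x
    rw [hcard, T.ncard_eq_one_iff]
    constructor
    · rintro ⟨j, hj⟩
      obtain ⟨k, rfl⟩ := Fin.exists_succAbove_eq (x := j) (y := i) fun h => x.2.1 (by rw [← hj, h])
      exact ⟨k, Subtype.ext hj⟩
    · rintro ⟨j, rfl⟩
      exact ⟨_, rfl⟩
  · intro x y hxy
    obtain ⟨u, w, S, huw, hS, hS'⟩ := exists_isCut_suppressLeaf hac hab hv ha hb x y hxy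
    obtain ⟨d, hd⟩ := T.exists_side_eq huw hS
    exact ⟨_, hS', d, by rw [hd]; rfl⟩

/-- The restriction of a subcubic tree to a subset of its leaves. -/
theorem SubcubicTree.exists_restrict {n N : ℕ} (hn : 2 ≤ n) (T : SubcubicTree N)
    (f : Fin n ↪ Fin N) :
    ∃ T' : SubcubicTree n, ∀ d' : T'.graph.Dart, ∃ d : T.graph.Dart,
      T'.side d' = f ⁻¹' T.side d := by
  induction N with
  | zero => exact (f ⟨0, by omega⟩).elim0
  | succ N ih =>
    have hle : n ≤ N + 1 := by simpa using Fintype.card_le_of_embedding f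
    -- If `f` is onto, it is a relabelling. Otherwise a leaf outside its range is deleted and `f`
    -- factors through the remaining ones.
    rcases hle.eq_or_lt with rfl | hlt
    · exact T.exists_relabel (Equiv.ofBijective f (Finite.injective_iff_bijective.1 f.injective))
    · obtain ⟨i, hi⟩ : ∃ i, i ∉ Set.range f := by
        by_contra! h
        have := Fintype.card_le_of_surjective f h
        simp at this
        omega
      have hex : ∀ k, ∃ j, i.succAbove j = f k := fun k =>
        Fin.exists_succAbove_eq fun h => hi ⟨k, h⟩
      choose g hg using hex
      let g' : Fin n ↪ Fin N := ⟨g, fun j k h => f.injective (by rw [← hg, ← hg, h])⟩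
      obtain ⟨T₁, h₁⟩ := T.exists_deleteLeaf (by omega) i
      obtain ⟨T₂, h₂⟩ := ih T₁ g'
      refine ⟨T₂, fun d₂ => ?_⟩
      obtain ⟨d₁, hd₁⟩ := h₂ d₂
      obtain ⟨d, hd⟩ := h₁ d₁
      refine ⟨d, ?_⟩
      rw [hd₁, hd, ← Set.preimage_comp]
      congr 1
      exact funext hg

/-! ### The entropic entanglement width -/

theorem le_maxEntropy {N : ℕ} {D : Type} [Fintype D] (T : SubcubicTree N) (ψ : MultiVec N D)
    (d : T.graph.Dart) : entanglementEntropy (T.side d) ψ ≤ T.maxEntropy ψ := by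
  refine le_ciSup (f := fun d => entanglementEntropy (T.side d) ψ) ?_ d
  refine ((Set.finite_range fun A : Set (Fin N) => entanglementEntropy A ψ).subset ?_).bddAbove
  rintro _ ⟨d, rfl⟩
  exact ⟨_, rfl⟩

theorem maxEntropy_nonneg {N : ℕ} {D : Type} [Fintype D] (T : SubcubicTree N) {ψ : MultiVec N D}
    (hψ : ‖ψ‖ = 1) : 0 ≤ T.maxEntropy ψ :=
  Real.iSup_nonneg fun _ => entanglementEntropy_nonneg _ hψ

/-- There are infinitely many trees up to the choice of vertex type, but each value is the supremum
of a subset of the finite set of entropies over all bipartitions. -/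
theorem widthValues_finite {N : ℕ} {D : Type} [Fintype D] (ψ : MultiVec N D) :
    (widthValues ψ).Finite := by
  have hfin := Set.finite_range fun A : Set (Fin N) => entanglementEntropy A ψ
  refine (hfin.finite_subsets.image sSup).subset ?_
  rintro _ ⟨T, rfl⟩
  refine ⟨Set.range fun d => entanglementEntropy (T.side d) ψ, ?_, rfl⟩
  rintro _ ⟨d, rfl⟩
  exact ⟨_, rfl⟩

theorem isLeast_entropicWidth {N : ℕ} (hN : 2 ≤ N) (ψ : QubitVec N) :
    IsLeast (widthValues ψ) (entropicWidth N ψ) := by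
  have hne : (widthValues ψ).Nonempty := by
    obtain ⟨T⟩ := nonempty_subcubicTree hN
    exact ⟨_, T, rfl⟩
  exact ⟨hne.csInf_mem (widthValues_finite ψ), fun w hw => csInf_le (widthValues_finite ψ).bddBelow hw⟩

theorem entropicWidth_nonneg {N : ℕ} {ψ : QubitVec N} (hψ : ‖ψ‖ = 1) : 0 ≤ entropicWidth N ψ := by
  refine Real.sInf_nonneg ?_
  rintro _ ⟨T, rfl⟩
  exact maxEntropy_nonneg T hψ

theorem entropicWidth_eq_zero {N : ℕ} {ψ : QubitVec N}
    (h : ∀ A : Set (Fin N), entanglementEntropy A ψ = 0) : entropicWidth N ψ = 0 := by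
  have h0 : ∀ w ∈ widthValues ψ, w = 0 := by
    rintro _ ⟨T, rfl⟩
    simp [SubcubicTree.maxEntropy, h]
  -- This also covers the case without trees, where the set of values is empty and its infimum is
  -- `0` by convention.
  exact le_antisymm (Real.sInf_nonpos fun w hw => (h0 w hw).le)
    (Real.sInf_nonneg fun w hw => (h0 w hw).ge)

theorem entanglementEntropy_eq_zero_of_le_one {n : ℕ} (hn : n ≤ 1) {φ : QubitVec n}
    (hφ : ‖φ‖ = 1) (A : Set (Fin n)) : entanglementEntropy A φ = 0 := by
  have : Subsingleton (Fin n) := Fin.subsingleton_iff_le_one.2 hn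
  rcases A.eq_empty_or_nonempty with h | h
  · exact entanglementEntropy_eq_zero_of_eq_empty h hφ
  · exact entanglementEntropy_eq_zero_of_eq_univ (Subsingleton.eq_univ_of_nonempty h) hφ

/-- If the entanglement of `φ` across every restricted bipartition is bounded by that of `ψ`, then
so is the width. -/
theorem entropicWidth_le_of_embedding {n N : ℕ} (f : Fin n ↪ Fin N) {ψ : QubitVec N}
    {φ : QubitVec n} (hψ : ‖ψ‖ = 1) (hφ : ‖φ‖ = 1)
    (h : ∀ A : Set (Fin N), entanglementEntropy (f ⁻¹' A) φ ≤ entanglementEntropy A ψ) :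
    entropicWidth n φ ≤ entropicWidth N ψ := by
  rcases Nat.lt_or_ge 1 n with hn | hn
  · have hle : n ≤ N := by simpa using Fintype.card_le_of_embedding f
    obtain ⟨T, hT⟩ := (isLeast_entropicWidth (hn.trans_le hle) ψ).1
    obtain ⟨T', hT'⟩ := T.exists_restrict hn f
    rw [hT]
    refine ((isLeast_entropicWidth hn φ).2 ⟨T', rfl⟩).trans
      (Real.iSup_le (fun d' => ?_) (maxEntropy_nonneg T hψ))
    obtain ⟨d, hd⟩ := hT' d'
    rw [hd]
    exact (h _).trans (le_maxEntropy T ψ d)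
  · rw [entropicWidth_eq_zero (entanglementEntropy_eq_zero_of_le_one hn hφ)]
    exact entropicWidth_nonneg hψ

theorem isTypeIIMonotone_entropicWidth : IsTypeIIMonotone entropicWidth := by
  rintro N n - ψ φ hψ hφ ⟨f, hf⟩
  refine entropicWidth_le_of_embedding f hψ hφ fun A => ?_
  -- The entropy of `φ` across a restricted bipartition is that of the padded state across the full
  -- one, to which LOCC monotonicity applies.
  rw [← entanglementEntropy_padZero f hφ]
  exact hf.entanglementEntropy_le hψ ((vecEntropy_padZero f φ ∅).2.trans hφ) A

/-- For two or more qubits, inserting a leaf into an optimal tree gives `≤`, the additional cuts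
having entropy zero, and restriction to the old leaves gives `≥`. With at most one qubit in `ψ`, all
entropies vanish on both sides. -/
theorem entropicWidth_appendZero {N : ℕ} {ψ : QubitVec N} (hψ : ‖ψ‖ = 1) :
    entropicWidth (N + 1) (appendZero ψ) = entropicWidth N ψ := by
  have hent : ∀ A : Set (Fin (N + 1)), entanglementEntropy A (appendZero ψ) =
      entanglementEntropy (Fin.castSucc ⁻¹' A) ψ :=
    entanglementEntropy_padZero Fin.castSuccEmb hψ
  have hnorm : ‖appendZero ψ‖ = 1 := (vecEntropy_padZero Fin.castSuccEmb ψ ∅).2.trans hψ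
  rcases Nat.lt_or_ge 1 N with hN | hN
  · refine le_antisymm ?_
      (entropicWidth_le_of_embedding Fin.castSuccEmb hnorm hψ fun A => (hent A).ge)
    obtain ⟨T, hT⟩ := (isLeast_entropicWidth hN ψ).1
    obtain ⟨T', hT'⟩ := T.exists_insertLeaf (zero_lt_one.trans hN)
    rw [hT]
    refine ((isLeast_entropicWidth (hN.trans N.lt_succ_self) (appendZero ψ)).2 ⟨T', rfl⟩).trans
      (Real.iSup_le (fun d' => ?_) (maxEntropy_nonneg T hψ))
    rw [hent]
    rcases hT' d' with h | h | ⟨d, hd⟩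
    · rw [entanglementEntropy_eq_zero_of_eq_empty h hψ]
      exact maxEntropy_nonneg T hψ
    · rw [entanglementEntropy_eq_zero_of_eq_univ h hψ]
      exact maxEntropy_nonneg T hψ
    · rw [hd]
      exact le_maxEntropy T ψ d
  · rw [entropicWidth_eq_zero (entanglementEntropy_eq_zero_of_le_one hN hψ), entropicWidth_eq_zero]
    intro A
    rw [hent, entanglementEntropy_eq_zero_of_le_one hN hψ]

end EntWidth

end

theorem mainTheorem3 :
    (∀ (N : ℕ), 2 ≤ N → ∀ ψ : EntWidth.QubitVec N, ‖ψ‖ = 1 →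
      IsLeast (EntWidth.widthValues ψ) (EntWidth.entropicWidth N ψ)) ∧
    EntWidth.IsTypeIIMonotone EntWidth.entropicWidth ∧
    (∀ (N : ℕ) (ψ : EntWidth.QubitVec N), ‖ψ‖ = 1 →
      EntWidth.entropicWidth (N + 1) (EntWidth.appendZero ψ) = EntWidth.entropicWidth N ψ) :=
  ⟨fun _ hN ψ _ => EntWidth.isLeast_entropicWidth hN ψ, EntWidth.isTypeIIMonotone_entropicWidth,
    fun _ _ hψ => EntWidth.entropicWidth_appendZero hψ⟩
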